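/- A semigroup $S$ is \emph{3-nilpotent} if it has a zero element $0$, $abc=0$ for all $a,b,c\in S$, and $ab\neq 0$ for some $a,b\in S$. It is \emph{semirigid} if every automorphism of $S$ fixes every element of $S^2=\{ab : a,b\in S\}$, and \emph{self-dual} if it is isomorphic to its dual (opposite) semigroup; an isomorphism class is called self-dual if its members are. Let $\left\{{m\atop k}\right\}$ denote the Stirling number of the second kind. For $p,q\ge 0$ let $Y,Y'$ be disjoint $p$-element sets in bijection via $y\leftrightarrow y'$, and let $a_{p,q}$ be the number of partitions of $Y\cup Y'$ into exactly $2q$ blocks that are invariant as a partition under the exchange $y\leftrightarrow y'$ and in which no block contains both $y$ and $y'$ for any $y\in Y$. For an integer partition $\lambda\vdash r$ with parts $\lambda_1,\dots,\lambda_s$ (listed with repetition), put $e_i=1$ if $\lambda_i$ is even and $e_i=0$ otherwise; $f_i=1$ if $\lambda_i\equiv 2 \pmod 4$ and $f_i=0$ otherwise; $e_{ij}=1$ if at least one of $\lambda_i,\lambda_j$ is even and $e_{ij}=0$ otherwise; and $$\zeta(\lambda)=\frac12\sum_{i}\bigl((1+e_i)(\lambda_i+1)-2(f_i+1)\bigr)+\sum_{i<j}(1+e_{ij})\gcd(\lambda_i,\lambda_j),\qquad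 \eta(\lambda)=\sum_i(1-e_i+2f_i).$$ Let $w(\lambda)=\prod_{l} l^{\mu_l}\,\mu_l!$, where $l$ runs over the distinct parts of $\lambda$ and $\mu_l$ is the multiplicity of $l$. \textbf{Theorem.} For every $n$, the number of self-dual isomorphism classes of semirigid 3-nilpotent semigroups of order $n$ is bounded above by the rational number $$\sum_{r=1}^{n-2}\ \sum_{\lambda\vdash r}\frac{1}{w(\lambda)}\sum_{j=0}^{\zeta(\lambda)}\binom{\zeta(\lambda)}{j}\sum_{t=0}^{\min\{j,\lfloor (n-r-1)/2\rfloor\}}a_{j,t}\left\{{\zeta(\lambda)+\eta(\lambda)-j+1\atop n-r-2t}\right\},$$ and this number is also a lower bound for the number of self-dual isomorphism classes of all 3-nilpotent semigroups of order $n$. -/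

import Mathlib

open scoped BigOperators Nat

/-- `S` is 3-nilpotent: it has a zero `z`, `S ^ 3 = {z}`, and `S ^ 2 ≠ {z}`. -/
def IsThreeNilpotent (S : Type) [Semigroup S] : Prop :=
  ∃ z : S, (∀ x : S, z * x = z ∧ x * z = z) ∧ (∀ a b c : S, a * b * c = z) ∧
    ∃ a b : S, a * b ≠ z

/-- `S` is semirigid: every automorphism of `S` fixes every element of
`S ^ 2 = {a * b | a b : S}`. -/
def IsSemirigid (S : Type) [Semigroup S] : Prop :=
  ∀ f : S ≃* S, ∀ a b : S, f (a * b) = a * b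

/-- `S` is self-dual: it is isomorphic to its dual (opposite) semigroup. -/
def IsSelfDual (S : Type) [Semigroup S] : Prop :=
  Nonempty (S ≃* Sᵐᵒᵖ)

/-- The semigroup with underlying set `{0, …, n - 1}` and multiplication `s`.  (A separate type, so
that the modular multiplication of `Fin n` cannot interfere.) -/
def SemigroupOn {n : ℕ} (_s : Semigroup (Fin n)) : Type := Fin n

instance {n : ℕ} (s : Semigroup (Fin n)) : Semigroup (SemigroupOn s) := s

/-- Isomorphism of semigroups on the fixed set `Fin n`. -/
def semigroupIsoSetoid (n : ℕ) : Setoid (Semigroup (Fin n)) where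
  r s t := Nonempty (SemigroupOn s ≃* SemigroupOn t)
  iseqv :=
    ⟨fun s => ⟨MulEquiv.refl (SemigroupOn s)⟩, fun ⟨e⟩ => ⟨e.symm⟩,
      fun ⟨e⟩ ⟨f⟩ => ⟨e.trans f⟩⟩

/-- Isomorphism classes of semigroups of order `n`. -/
def SemigroupIsoClass (n : ℕ) : Type := Quotient (semigroupIsoSetoid n)

/-- The isomorphism class of a semigroup on `Fin n`. -/
def isoClassOf {n : ℕ} (s : Semigroup (Fin n)) : SemigroupIsoClass n :=
  Quotient.mk (semigroupIsoSetoid n) s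

/-- There are finitely many isomorphism classes of semigroups of order `n`, so that the cardinalities
`Set.ncard` of sets of classes below are genuine. -/
instance finite_semigroupIsoClass (n : ℕ) : Finite (SemigroupIsoClass n) := by
  have hfin : Finite (Semigroup (Fin n)) :=
    Finite.of_injective (fun s : Semigroup (Fin n) => fun a b : Fin n => s.mul a b)
      (by
        intro s t h
        apply Semigroup.ext
        exact h)
  exact Quotient.finite _

/-- The self-dual isomorphism classes of 3-nilpotent semigroups of order `n`. -/
def selfDualThreeNilpotentClasses (n : ℕ) : Set (SemigroupIsoClass n) :=
  isoClassOf '' {s | IsThreeNilpotent (SemigroupOn s) ∧ IsSelfDual (SemigroupOn s)}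

/-- The self-dual isomorphism classes of semirigid 3-nilpotent semigroups of order `n`. -/
def selfDualSemirigidThreeNilpotentClasses (n : ℕ) : Set (SemigroupIsoClass n) :=
  isoClassOf '' {s | IsThreeNilpotent (SemigroupOn s) ∧ IsSemirigid (SemigroupOn s) ∧
    IsSelfDual (SemigroupOn s)}

/-- `a_{p,q}`: the number of partitions of `Y ∪ Y'` (two disjoint copies of a `p`-set, interchanged
by `y ↔ y'`) into exactly `2 q` blocks which are mapped to themselves by `y ↔ y'`, and in which
no block contains both `y` and `y'`. -/
noncomputable def orthogonalSelfDualCount (p q : ℕ) : ℕ :=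
  Nat.card {P : Finpartition (Finset.univ : Finset (Fin p ⊕ Fin p)) //
    P.parts.card = 2 * q ∧
    P.parts.image (fun B => B.image Sum.swap) = P.parts ∧
    ∀ B ∈ P.parts, ∀ y ∈ B, Sum.swap y ∉ B}

/-- `e = 1` if the part `l` is even, and `e = 0` otherwise. -/
def evenInd (l : ℕ) : ℕ := if l % 2 = 0 then 1 else 0

/-- `f = 1` if the part `l` is congruent to 2 modulo 4, and `f = 0` otherwise. -/
def twiceOddInd (l : ℕ) : ℕ := if l % 4 = 2 then 1 else 0

/-- `e_{ij} = 1` if at least one of the two parts is even, and `e_{ij} = 0` otherwise. -/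
def evenInd₂ (l m : ℕ) : ℕ := if l % 2 = 0 ∨ m % 2 = 0 then 1 else 0

/-- `η(λ) = ∑ᵢ (1 - eᵢ + 2 fᵢ)`; no truncation occurs, since `eᵢ ≤ 1`. -/
def partitionEta {r : ℕ} (lam : r.Partition) : ℕ :=
  (lam.parts.map fun l => 1 - evenInd l + 2 * twiceOddInd l).sum

/-- The parts of an integer partition in a list, `λ₁ ≥ λ₂ ≥ … ≥ λₛ`. -/
def partitionList {r : ℕ} (lam : r.Partition) : List ℕ := lam.parts.sort (· ≥ ·)

/-- `ζ(λ) = ½ ∑ᵢ ((1 + eᵢ)(λᵢ + 1) - 2(fᵢ + 1)) + ∑_{i<j} (1 + e_{ij}) gcd(λᵢ, λⱼ)`.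
For positive parts each term of the first sum is a non-negative even number, so neither the
subtraction nor the division is truncated. -/
def partitionZeta {r : ℕ} (lam : r.Partition) : ℕ :=
  (lam.parts.map fun l => (1 + evenInd l) * (l + 1) - 2 * (twiceOddInd l + 1)).sum / 2 +
    ∑ i : Fin (partitionList lam).length, ∑ j ∈ Finset.Ioi i,
      (1 + evenInd₂ ((partitionList lam).get i) ((partitionList lam).get j)) *
        Nat.gcd ((partitionList lam).get i) ((partitionList lam).get j)

/-- `w(λ) = λ₁^μ₁ ⋯ λₜ^μₜ μ₁! ⋯ μₜ!`, over the distinct parts `λᵢ` with multiplicities `μᵢ`. -/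
def partitionWeight {r : ℕ} (lam : r.Partition) : ℕ :=
  ∏ l ∈ lam.parts.toFinset, l ^ lam.parts.count l * (lam.parts.count l)!

/-- The double sum over `j` and `t` for an integer partition `λ` of `r`, with `k = n - r - 1`. -/
noncomputable def selfDualInnerSum (n : ℕ) {r : ℕ} (lam : r.Partition) : ℕ :=
  ∑ j ∈ Finset.range (partitionZeta lam + 1), (partitionZeta lam).choose j *
    ∑ t ∈ Finset.range (min j ((n - r - 1) / 2) + 1),
      orthogonalSelfDualCount j t *
        Nat.stirlingSecond (partitionZeta lam + partitionEta lam - j + 1) (n - r - 2 * t)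

/-- The bounding quantity, a rational number. -/
noncomputable def selfDualBound (n : ℕ) : ℚ :=
  ∑ r ∈ Finset.Icc 1 (n - 2), ∑ lam : r.Partition,
    (selfDualInnerSum n lam : ℚ) / (partitionWeight lam : ℚ)

/-! ### Counting equivalence relations -/

/-! A 3-nilpotent semigroup `S` with `A = S \ S²` of size `r` amounts to a partition of `A × A`,
with an extra point `none` standing for the zero, into `n - r` blocks, the blocks being the elements
of `S²` (`IsThreeNilpotent.exists_pairSemigroup`). Isomorphism becomes the action of the
permutations of `A`, and duality becomes exchange of coordinates.

For a permutation `σ` of `A` let `τ` be the twist `(a, b) ↦ (σ b, σ a)`. A partition `P` is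
preserved by `τ` exactly when `σ` carries the dual of `P` to `P`. A coset form of Burnside's lemma
shows that the pairs `(σ, P)` of this kind, with `P` in one isomorphism class, number `r!` if the
class is self-dual and 0 otherwise. Count only those pairs for which `τ²` also fixes every block.
Each self-dual class then contributes at most `r!`, every other class contributes 0, and a self-dual
semirigid class contributes exactly `r!`, because `τ²` is induced by the automorphism coming from
`σ²`. After division by `r!` the total lies between the two numbers of classes
(`classWeight_eq_one`, `classWeight_le_one`).

It remains to evaluate the total. For fixed `σ` the admissible `P` are the partitions of the set of
orbits of `τ²` that are invariant under the involution induced by `τ` (`natCard_isTwistInvariant`).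
Burnside counts give this involution `η + 1` fixed points and `ζ` exchanged pairs. An invariant
partition is determined by the set of `j` pairs whose members lie in different blocks, an orthogonal
partition of these pairs into `2t` blocks, and an arbitrary partition of the other `ζ - j` pairs,
each merged to a point, together with the fixed points (`natCard_isSwapInvariant`). The count
depends only on the cycle type `λ` of `σ`, which a proportion `1 / w(λ)` of all permutations share
(`sum_partition_div_weight`). -/

theorem natCard_subtype_eq_sum {α : Type*} [Fintype α] (p : α → Prop) [DecidablePred p] :
    Nat.card {x // p x} = ∑ x, if p x then 1 else 0 := by
  rw [Nat.card_eq_fintype_card, Fintype.card_subtype, Finset.card_filter]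

theorem natCard_quotient_ker {α β : Type*} (f : α → β) (hf : Function.Surjective f) :
    Nat.card (Quotient (Setoid.ker f)) = Nat.card β :=
  Nat.card_congr (Setoid.quotientKerEquivOfSurjective f hf)

theorem natCard_quotient_comap {α β : Type*} (f : α → β) (hf : Function.Surjective f)
    (P : Setoid β) : Nat.card (Quotient (P.comap f)) = Nat.card (Quotient P) := by
  rw [Setoid.comap_eq]
  exact natCard_quotient_ker _ (Quotient.mk''_surjective.comp hf)

/-- Transport of equivalence relations along a bijection. -/
def setoidCongr {α β : Type*} (e : α ≃ β) : Setoid β ≃ Setoid α where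
  toFun P := P.comap e
  invFun P := P.comap e.symm
  left_inv P := by ext x y; simp [Setoid.comap_rel]
  right_inv P := by ext x y; simp [Setoid.comap_rel]

/-- The equivalence relation on `Option α` that extends `P` and puts `none` into the class `c`,
or into a class of its own. -/
def optionSetoid {α : Type*} (x : Σ P : Setoid α, Option (Quotient P)) : Setoid (Option α) :=
  Setoid.ker fun o : Option α => o.elim x.2 fun a => some (Quotient.mk x.1 a)

theorem optionSetoid_rel {α : Type*} (x : Σ P : Setoid α, Option (Quotient P)) (o o' : Option α) :
    optionSetoid x o o' ↔ (o.elim x.2 fun a => some (Quotient.mk x.1 a)) =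
      o'.elim x.2 fun a => some (Quotient.mk x.1 a) := Iff.rfl

/-- Restriction to `α` recovers `P`, and the elements related to `none` recover the class it joins.
This is the bijection behind the Stirling recurrence. -/
theorem optionSetoid_bijective {α : Type*} : Function.Bijective (optionSetoid (α := α)) := by
  constructor
  · rintro ⟨P, c⟩ ⟨Q, d⟩ h
    have hPQ : P = Q := by
      ext x y
      have := congrArg (fun R : Setoid (Option α) => R (some x) (some y)) h
      simpa [optionSetoid_rel, Quotient.eq] using iff_of_eq this
    subst hPQ
    have hn : ∀ a, c = some (Quotient.mk P a) ↔ d = some (Quotient.mk P a) := by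
      intro a
      have := congrArg (fun R : Setoid (Option α) => R none (some a)) h
      simpa [optionSetoid_rel] using iff_of_eq this
    congr 1
    cases c with
    | some q =>
      induction q using Quotient.inductionOn with
      | h a => exact ((hn a).1 rfl).symm
    | none =>
      cases d with
      | none => rfl
      | some q =>
        induction q using Quotient.inductionOn with
        | h a => exact absurd ((hn a).2 rfl) (by simp)
  · intro Q
    have key : ∀ x y, (Q.comap some) x y ↔ Q (some x) (some y) := fun x y => Iff.rfl
    by_cases h : ∃ a, Q none (some a)
    · obtain ⟨a, ha⟩ := h
      refine ⟨⟨Q.comap some, some (Quotient.mk _ a)⟩, ?_⟩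
      ext x y
      cases x <;> cases y <;> simp only [optionSetoid_rel, Option.elim, Option.some.injEq]
      · simp
      · rw [Quotient.eq, key]
        exact ⟨fun h => Q.trans' ha h, fun h => Q.trans' (Q.symm' ha) h⟩
      · rw [Quotient.eq, key]
        exact ⟨fun h => Q.trans' h (Q.symm' ha), fun h => Q.trans' h ha⟩
      · rw [Quotient.eq, key]
    · push Not at h
      refine ⟨⟨Q.comap some, none⟩, ?_⟩
      ext x y
      cases x <;> cases y <;> simp only [optionSetoid_rel, Option.elim, Option.some.injEq]
      · simp
      · simpa using h _
      · simpa using fun h' => h _ (Q.symm' h')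
      · rw [Quotient.eq, key]

theorem natCard_quotient_optionSetoid_none {α : Type*} [Finite α] (P : Setoid α) :
    Nat.card (Quotient (optionSetoid ⟨P, none⟩)) = Nat.card (Quotient P) + 1 := by
  rw [optionSetoid, natCard_quotient_ker]
  · simp
  · rintro (_ | q)
    · exact ⟨none, rfl⟩
    · induction q using Quotient.inductionOn with
      | h a => exact ⟨some a, rfl⟩

theorem natCard_quotient_optionSetoid_some {α : Type*} (P : Setoid α) (c : Quotient P) :
    Nat.card (Quotient (optionSetoid ⟨P, some c⟩)) = Nat.card (Quotient P) := by
  have : optionSetoid ⟨P, some c⟩ =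
      Setoid.ker fun o : Option α => o.elim c fun a => Quotient.mk P a := by
    ext x y
    cases x <;> cases y <;> simp [optionSetoid_rel, Setoid.ker_def]
  rw [this, natCard_quotient_ker]
  intro q
  induction q using Quotient.inductionOn with
  | h a => exact ⟨some a, rfl⟩

instance Setoid.instFiniteOfFinite {α : Type*} [Finite α] : Finite (Setoid α) :=
  Finite.of_injective (fun P : Setoid α => fun x y => P x y) fun P Q h => by
    ext x y; exact iff_of_eq (congrFun (congrFun h x) y)

theorem natCard_setoid_eq_stirlingSecond (α : Type*) [Finite α] (k : ℕ) :
    Nat.card {P : Setoid α // Nat.card (Quotient P) = k} = Nat.stirlingSecond (Nat.card α) k := by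
  classical
  induction α using Finite.induction_empty_option generalizing k with
  | of_equiv e ih =>
    rw [← Nat.card_congr e, ← ih k]
    refine Nat.card_congr ((setoidCongr e).subtypeEquiv fun P => ?_)
    rw [setoidCongr, Equiv.coe_fn_mk, natCard_quotient_comap _ e.surjective]
  | h_empty =>
    have h0 : ∀ P : Setoid PEmpty, Nat.card (Quotient P) = 0 := fun P => by
      have : IsEmpty (Quotient P) := ⟨fun q => q.inductionOn fun a => a.elim⟩
      simp
    cases k with
    | zero =>
      have : Unique {P : Setoid PEmpty // Nat.card (Quotient P) = 0} :=
        { default := ⟨⊥, h0 _⟩, uniq := fun P => Subtype.ext (by ext x; exact x.elim) }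
      rw [Nat.card_unique]; simp
    | succ k =>
      have : IsEmpty {P : Setoid PEmpty // Nat.card (Quotient P) = k + 1} :=
        ⟨fun P => by have := P.2; rw [h0] at this; omega⟩
      rw [Nat.card_of_isEmpty]; simp
  | @h_option α _ ih =>
    have := Fintype.ofFinite (Setoid α)
    have : ∀ P : Setoid α, Fintype (Quotient P) := fun P => Fintype.ofFinite _
    rw [← Nat.card_congr ((Equiv.ofBijective _ optionSetoid_bijective).subtypeEquiv
      (p := fun x => Nat.card (Quotient (optionSetoid x)) = k) fun x => Iff.rfl),
      natCard_subtype_eq_sum, Fintype.sum_sigma]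
    simp only [Fintype.sum_option, natCard_quotient_optionSetoid_none,
      natCard_quotient_optionSetoid_some, Finset.sum_const, Finset.card_univ, smul_eq_mul]
    rw [Finset.sum_add_distrib]
    -- A partition with `k` blocks has `k` extensions in which the new point joins an old block;
    -- this is the term `k · S(m, k)` of the recurrence.
    have h2 : ∑ P : Setoid α, Fintype.card (Quotient P) * (if Nat.card (Quotient P) = k then 1 else 0)
        = k * Nat.stirlingSecond (Nat.card α) k := by
      rw [← ih k, natCard_subtype_eq_sum, Finset.mul_sum]
      refine Finset.sum_congr rfl fun P _ => ?_
      split_ifs with h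
      · rw [← h, Nat.card_eq_fintype_card]
      · simp
    rw [h2, Finite.card_option]
    cases k with
    | zero => simp
    | succ k =>
      simp only [add_left_inj]
      rw [← natCard_subtype_eq_sum, ih k, Nat.stirlingSecond_succ_succ]
      ring

/-! ### Involutions and orthogonal partitions -/

/-- The equivalence relation is invariant under the exchange of the two copies of `Y`, and no
element is related to its copy. -/
def IsOrthogonal {Y : Type*} (P : Setoid (Y ⊕ Y)) : Prop :=
  (∀ x y, P x y → P x.swap y.swap) ∧ ∀ x, ¬ P x x.swap

theorem Finpartition.mem_parts_ofSetoid {α : Type*} [Fintype α] [DecidableEq α] (P : Setoid α)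
    [DecidableRel P.r] (B : Finset α) :
    B ∈ (Finpartition.ofSetoid P).parts ↔ ∃ a, ∀ b, b ∈ B ↔ P a b := by
  change B ∈ Finset.univ.image _ ↔ _
  rw [Finset.mem_image]
  constructor
  · rintro ⟨a, -, rfl⟩
    exact ⟨a, fun b => by rw [Finset.mem_filter, and_iff_right (Finset.mem_univ b)]⟩
  · rintro ⟨a, ha⟩
    refine ⟨a, Finset.mem_univ a, ?_⟩
    ext b
    rw [ha, Finset.mem_filter, and_iff_right (Finset.mem_univ b)]

open Classical in
theorem Finpartition.ofSetoid_bijective (α : Type*) [Fintype α] [DecidableEq α] :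
    Function.Bijective fun P : Setoid α => Finpartition.ofSetoid P := by
  constructor
  · intro P Q h
    ext a b
    rw [← Finpartition.mem_part_ofSetoid_iff_rel (s := P),
      ← Finpartition.mem_part_ofSetoid_iff_rel (s := Q)]
    exact iff_of_eq (congrArg (fun R : Finpartition (Finset.univ : Finset α) => b ∈ R.part a) h)
  · intro P
    refine ⟨Setoid.ker P.part, ?_⟩
    ext B
    rw [Finpartition.mem_parts_ofSetoid]
    have key : ∀ a b, Setoid.ker P.part a b ↔ b ∈ P.part a := by
      intro a b
      rw [Setoid.ker_def,
        P.mem_part_iff_part_eq_part (Finset.mem_univ _) (Finset.mem_univ _), eq_comm]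
    simp only [key]
    constructor
    · rintro ⟨a, ha⟩
      rw [Finset.ext ha]
      exact P.part_mem.2 (Finset.mem_univ a)
    · intro hB
      obtain ⟨a, ha⟩ := P.nonempty_of_mem_parts hB
      exact ⟨a, fun b => by rw [P.part_eq_of_mem hB ha]⟩

theorem Finpartition.card_parts_ofSetoid {α : Type*} [Fintype α] [DecidableEq α] (P : Setoid α)
    [DecidableRel P.r] : (Finpartition.ofSetoid P).parts.card = Nat.card (Quotient P) := by
  let f : α → Finset α := fun a => Finset.univ.filter fun b => P.r a b
  have h1 : (Finpartition.ofSetoid P).parts = Finset.univ.image f := rfl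
  have h2 : P = Setoid.ker f := by
    ext a b
    rw [Setoid.ker_def]
    constructor
    · intro h
      ext c
      rw [Finset.mem_filter, Finset.mem_filter]
      exact and_congr Iff.rfl
        ⟨fun h' => P.trans' (P.symm' h) h', fun h' => P.trans' h h'⟩
    · intro h
      have : b ∈ f b := Finset.mem_filter.2 ⟨Finset.mem_univ b, P.refl' b⟩
      rw [← h] at this
      exact (Finset.mem_filter.1 this).2
  rw [h1]
  conv_rhs => rw [h2]
  rw [Nat.card_congr (Setoid.quotientKerEquivRange f), Nat.card_eq_fintype_card,
    ← Set.toFinset_card, Set.toFinset_range]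

theorem isOrthogonal_iff_ofSetoid {Y : Type*} [Fintype Y] [DecidableEq (Y ⊕ Y)] (P : Setoid (Y ⊕ Y))
    [DecidableRel P.r] :
    IsOrthogonal P ↔
      (Finpartition.ofSetoid P).parts.image (fun B => B.image Sum.swap) =
        (Finpartition.ofSetoid P).parts ∧
      ∀ B ∈ (Finpartition.ofSetoid P).parts, ∀ y ∈ B, Sum.swap y ∉ B := by
  have mem_swap : ∀ (B : Finset (Y ⊕ Y)) c, c ∈ B.image Sum.swap ↔ c.swap ∈ B := by
    intro B c
    rw [Finset.mem_image]
    constructor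
    · rintro ⟨b, hb, rfl⟩
      rwa [Sum.swap_swap]
    · exact fun hc => ⟨_, hc, Sum.swap_swap _⟩
  refine and_congr ⟨fun h => ?_, fun h x y hxy => ?_⟩ ⟨fun h => ?_, fun h x hx => ?_⟩
  · ext B
    rw [Finset.mem_image, Finpartition.mem_parts_ofSetoid]
    constructor
    · rintro ⟨C, hC, rfl⟩
      obtain ⟨a, ha⟩ := (Finpartition.mem_parts_ofSetoid _ _).1 hC
      refine ⟨a.swap, fun b => ?_⟩
      rw [mem_swap, ha]
      exact ⟨fun hb => by simpa using h _ _ hb, fun hb => by simpa using h _ _ hb⟩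
    · rintro ⟨a, ha⟩
      refine ⟨B.image Sum.swap, (Finpartition.mem_parts_ofSetoid _ _).2 ⟨a.swap, fun b => ?_⟩, ?_⟩
      · rw [mem_swap, ha]
        exact ⟨fun hb => by simpa using h _ _ hb, fun hb => by simpa using h _ _ hb⟩
      · ext c
        rw [mem_swap, mem_swap, Sum.swap_swap]
  · have hB : Finset.univ.filter (fun b => P.r x b) ∈ (Finpartition.ofSetoid P).parts :=
      (Finpartition.mem_parts_ofSetoid _ _).2 ⟨x, fun b => by
        rw [Finset.mem_filter, and_iff_right (Finset.mem_univ b)]⟩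
    have := Finset.mem_image_of_mem (fun B => B.image Sum.swap) hB
    rw [h] at this
    obtain ⟨a, ha⟩ := (Finpartition.mem_parts_ofSetoid _ _).1 this
    have hx := (ha x.swap).1 (by
      rw [mem_swap, Sum.swap_swap]; exact Finset.mem_filter.2 ⟨Finset.mem_univ _, P.refl' x⟩)
    have hy := (ha y.swap).1 (by
      rw [mem_swap, Sum.swap_swap]; exact Finset.mem_filter.2 ⟨Finset.mem_univ _, hxy⟩)
    exact P.trans' (P.symm' hx) hy
  · intro B hB y hy hy'
    obtain ⟨a, ha⟩ := (Finpartition.mem_parts_ofSetoid _ _).1 hB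
    exact h y (P.trans' (P.symm' ((ha _).1 hy)) ((ha _).1 hy'))
  · exact h _ ((Finpartition.mem_parts_ofSetoid P (Finset.univ.filter fun b => P.r x b)).2
      ⟨x, fun b => by rw [Finset.mem_filter, and_iff_right (Finset.mem_univ b)]⟩) x
      (Finset.mem_filter.2 ⟨Finset.mem_univ _, P.refl' x⟩)
      (Finset.mem_filter.2 ⟨Finset.mem_univ _, hx⟩)

theorem orthogonalSelfDualCount_eq_natCard (p q : ℕ) :
    orthogonalSelfDualCount p q =
      Nat.card {P : Setoid (Fin p ⊕ Fin p) // IsOrthogonal P ∧ Nat.card (Quotient P) = 2 * q} := by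
  classical
  refine (Nat.card_congr ((Equiv.ofBijective _
    (Finpartition.ofSetoid_bijective (Fin p ⊕ Fin p))).subtypeEquiv fun P => ?_)).symm
  rw [Equiv.ofBijective_apply, isOrthogonal_iff_ofSetoid, Finpartition.card_parts_ofSetoid, and_comm]

theorem natCard_isOrthogonal (Y : Type*) [Finite Y] (q : ℕ) :
    Nat.card {P : Setoid (Y ⊕ Y) // IsOrthogonal P ∧ Nat.card (Quotient P) = 2 * q} =
      orthogonalSelfDualCount (Nat.card Y) q := by
  rw [orthogonalSelfDualCount_eq_natCard]
  have e := Finite.equivFin Y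
  refine Nat.card_congr ((setoidCongr (Equiv.sumCongr e.symm e.symm)).subtypeEquiv fun P => ?_)
  rw [setoidCongr, Equiv.coe_fn_mk, natCard_quotient_comap _ (Equiv.surjective _)]
  refine and_congr ?_ Iff.rfl
  refine and_congr ⟨fun h x y hxy => ?_, fun h x y hxy => ?_⟩ ⟨fun h x => ?_, fun h x => ?_⟩
  · have := h _ _ hxy
    rw [Setoid.comap_rel]
    cases x <;> cases y <;> exact this
  · have := h ((Equiv.sumCongr e e) x) ((Equiv.sumCongr e e) y) (by
      rw [Setoid.comap_rel]; cases x <;> cases y <;> simpa using hxy)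
    rw [Setoid.comap_rel] at this
    cases x <;> cases y <;> simpa using this
  · have := h ((Equiv.sumCongr e.symm e.symm) x)
    rw [Setoid.comap_rel]
    cases x <;> exact this
  · have := h ((Equiv.sumCongr e e) x)
    rw [Setoid.comap_rel] at this
    cases x <;> simpa using this

/-- A finite type with an involution consists of its fixed points and of two copies of a type that
are exchanged by the involution. -/
theorem Function.Involutive.exists_equiv_sum {Z : Type*} [Finite Z] {θ : Z → Z}
    (hθ : Function.Involutive θ) :
    ∃ (Y : Type) (_ : Finite Y) (e : (Y ⊕ Y) ⊕ {z // θ z = z} ≃ Z),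
      ∀ x, θ (e x) = e (Sum.map Sum.swap id x) := by
  have i := Finite.equivFin Z
  -- An enumeration of `Z` selects from each exchanged pair the member of smaller index.
  let Y := {k : Fin (Nat.card Z) // k < i (θ (i.symm k))}
  refine ⟨Y, inferInstance, Equiv.ofBijective
    (Sum.elim (Sum.elim (fun y => i.symm y.1) fun y => θ (i.symm y.1)) Subtype.val) ⟨?_, ?_⟩, ?_⟩
  · have h1 : ∀ y y' : Y, i.symm y.1 ≠ θ (i.symm y'.1) := by
      intro y y' h
      have a := y.2
      have b := y'.2
      rw [h, hθ] at a
      rw [← h] at b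
      simp only [Equiv.apply_symm_apply] at a b
      exact lt_asymm a b
    have h2 : ∀ (y : Y) (z : Z), θ z = z → i.symm y.1 ≠ z := by
      rintro y _ hz rfl
      have a := y.2
      rw [hz] at a
      simp at a
    have h3 : ∀ (y : Y) (z : Z), θ z = z → θ (i.symm y.1) ≠ z := by
      intro y z hz h
      exact h2 y z hz (hθ.injective (h.trans hz.symm))
    rintro ((y | y) | ⟨z, hz⟩) ((y' | y') | ⟨z', hz'⟩) h <;>
      simp only [Sum.elim_inl, Sum.elim_inr] at h
    · rw [Subtype.ext (i.symm.injective h)]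
    · exact absurd h (h1 _ _)
    · exact absurd h (h2 _ _ hz')
    · exact absurd h.symm (h1 _ _)
    · rw [Subtype.ext (i.symm.injective (hθ.injective h))]
    · exact absurd h (h3 _ _ hz')
    · exact absurd h.symm (h2 _ _ hz)
    · exact absurd h.symm (h3 _ _ hz)
    · subst h; rfl
  · intro z
    rcases lt_trichotomy (i z) (i (θ z)) with h | h | h
    · exact ⟨Sum.inl (Sum.inl ⟨i z, by simpa using h⟩), by simp⟩
    · exact ⟨Sum.inr ⟨z, (i.injective h).symm⟩, rfl⟩
    · exact ⟨Sum.inl (Sum.inr ⟨i (θ z), by simpa [hθ z] using h⟩), by simp [hθ z]⟩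
  · rintro ((y | y) | ⟨z, hz⟩)
    · rfl
    · exact hθ _
    · exact hz

/-- The swap acts on the blocks as an involution, without fixed blocks since no block meets its own
image in a copy of one of its elements; hence the blocks pair up. -/
theorem IsOrthogonal.even_natCard_quotient {Y : Type*} [Finite Y] {P : Setoid (Y ⊕ Y)}
    (hP : IsOrthogonal P) : ∃ t ≤ Nat.card Y, Nat.card (Quotient P) = 2 * t := by
  let θ : Quotient P → Quotient P := Quotient.map Sum.swap hP.1
  have hθ : Function.Involutive θ := by
    intro z
    induction z using Quotient.inductionOn with
    | h x => simp [θ]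
  obtain ⟨T, _, e, -⟩ := hθ.exists_equiv_sum
  have : IsEmpty {z // θ z = z} := by
    refine ⟨?_⟩
    rintro ⟨z, hz⟩
    induction z using Quotient.inductionOn with
    | h x => exact hP.2 x (P.symm' (Quotient.exact hz))
  have hc : Nat.card (Quotient P) = 2 * Nat.card T := by
    rw [← Nat.card_congr e]; simp [Nat.card_sum]; ring
  refine ⟨_, ?_, hc⟩
  have := Nat.card_le_card_of_surjective (Quotient.mk P) Quotient.mk_surjective
  rw [hc, Nat.card_sum] at this
  omega

/-! ### Counting equivalence relations that are invariant under an involution -/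

/-- The equivalence relation on a disjoint sum whose restrictions are `P` and `Q`, and which does
not relate the two summands. -/
def sumSetoid {α β : Type*} (P : Setoid α) (Q : Setoid β) : Setoid (α ⊕ β) :=
  Setoid.ker (Sum.map (Quotient.mk P) (Quotient.mk Q))

theorem sumSetoid_rel {α β : Type*} (P : Setoid α) (Q : Setoid β) (x y : α ⊕ β) :
    sumSetoid P Q x y ↔
      Sum.map (Quotient.mk P) (Quotient.mk Q) x = Sum.map (Quotient.mk P) (Quotient.mk Q) y :=
  Iff.rfl

theorem natCard_quotient_sumSetoid {α β : Type*} [Finite α] [Finite β]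
    (P : Setoid α) (Q : Setoid β) :
    Nat.card (Quotient (sumSetoid P Q)) = Nat.card (Quotient P) + Nat.card (Quotient Q) := by
  rw [sumSetoid, natCard_quotient_ker _
    (Sum.map_surjective.2 ⟨Quotient.mk_surjective, Quotient.mk_surjective⟩), Nat.card_sum]

theorem sumSetoid_comap {α β : Type*} (R : Setoid (α ⊕ β))
    (h : ∀ a b, ¬ R (Sum.inl a) (Sum.inr b)) :
    sumSetoid (R.comap Sum.inl) (R.comap Sum.inr) = R := by
  ext x y
  rw [sumSetoid_rel]
  rcases x with x | x <;> rcases y with y | y <;>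
    simp only [Sum.map_inl, Sum.map_inr, Sum.inl.injEq, Sum.inr.injEq, reduceCtorEq, false_iff]
  · rw [Quotient.eq]; rfl
  · exact h x y
  · exact fun h' => h y x (R.symm' h')
  · rw [Quotient.eq]; rfl

/-- If the orthogonal part has `2t` blocks, the other part is any partition of `V` into `k - 2t`
blocks. Since `V` is nonempty, `S(|V|, 0) = 0`, so terms in which the subtraction truncates vanish.
-/
theorem natCard_isOrthogonal_prod (Y V : Type*) [Finite Y] [Finite V] [Nonempty V] (k : ℕ) :
    Nat.card {P : Setoid (Y ⊕ Y) × Setoid V //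
        IsOrthogonal P.1 ∧ Nat.card (Quotient P.1) + Nat.card (Quotient P.2) = k} =
      ∑ t ∈ Finset.range (min (Nat.card Y) ((k - 1) / 2) + 1),
        orthogonalSelfDualCount (Nat.card Y) t * Nat.stirlingSecond (Nat.card V) (k - 2 * t) := by
  classical
  have := Fintype.ofFinite (Setoid (Y ⊕ Y))
  have := Fintype.ofFinite (Setoid V)
  have hV : Nat.stirlingSecond (Nat.card V) 0 = 0 := by
    obtain ⟨m, hm⟩ := Nat.exists_eq_succ_of_ne_zero (Nat.card_pos (α := V)).ne'
    rw [hm, Nat.stirlingSecond_succ_zero]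
  have hvan : ∀ m, k ≤ m → Nat.stirlingSecond (Nat.card V) (k - m) = 0 := by
    intro m hm
    rw [Nat.sub_eq_zero_of_le hm, hV]
  have hpos : ∀ Q : Setoid V, 0 < Nat.card (Quotient Q) := fun Q =>
    have := (inferInstance : Nonempty V).map (Quotient.mk Q)
    Nat.card_pos
  rw [natCard_subtype_eq_sum, Fintype.sum_prod_type]
  have h1 : ∀ P : Setoid (Y ⊕ Y), (∑ Q : Setoid V,
      if IsOrthogonal P ∧ Nat.card (Quotient P) + Nat.card (Quotient Q) = k then 1 else 0) =
      ∑ t ∈ Finset.range (Nat.card Y + 1),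
        (if IsOrthogonal P ∧ Nat.card (Quotient P) = 2 * t then 1 else 0) *
          Nat.stirlingSecond (Nat.card V) (k - 2 * t) := by
    intro P
    by_cases hP : IsOrthogonal P
    · obtain ⟨t, ht, hPt⟩ := hP.even_natCard_quotient
      rw [Finset.sum_eq_single t]
      · simp only [hP, hPt, true_and, if_true, one_mul]
        rcases lt_or_ge (2 * t) k with h | h
        · rw [← natCard_setoid_eq_stirlingSecond, natCard_subtype_eq_sum]
          refine Finset.sum_congr rfl fun Q _ => ?_
          congr 1
          exact propext (by omega)
        · rw [hvan _ h]
          refine Finset.sum_eq_zero fun Q _ => if_neg ?_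
          have := hpos Q
          omega
      · intro s _ hs
        rw [if_neg (by omega), zero_mul]
      · intro h
        exact absurd (Finset.mem_range.2 (by omega)) h
    · simp [hP]
  simp only [h1]
  rw [Finset.sum_comm]
  simp only [← Finset.sum_mul, ← natCard_subtype_eq_sum, natCard_isOrthogonal]
  symm
  -- Values `t > (k - 1) / 2` satisfy `k ≤ 2t` and contribute nothing.
  refine Finset.sum_subset (Finset.range_subset_range.2 (by omega)) fun t ht ht' => ?_
  simp only [Finset.mem_range] at ht ht'
  rw [hvan _ (by omega), mul_zero]

section Split

variable {Y W : Type*} (J : Set Y)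

/-- The inclusion of the `J`-part and of representatives of the remaining pairs and points. -/
def splitIncl : (J ⊕ J) ⊕ (↥Jᶜ ⊕ W) → (Y ⊕ Y) ⊕ W :=
  Sum.elim (fun x => Sum.inl (Sum.map Subtype.val Subtype.val x))
    (Sum.map (fun y => Sum.inl y.1) id)

open Classical in
/-- The retraction of `splitIncl` that identifies the two copies of each `y ∉ J`. -/
noncomputable def splitProj : (Y ⊕ Y) ⊕ W → (J ⊕ J) ⊕ (↥Jᶜ ⊕ W) :=
  Sum.elim
    (Sum.elim
      (fun y => if h : y ∈ J then Sum.inl (Sum.inl ⟨y, h⟩) else Sum.inr (Sum.inl ⟨y, h⟩))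
      (fun y => if h : y ∈ J then Sum.inl (Sum.inr ⟨y, h⟩) else Sum.inr (Sum.inl ⟨y, h⟩)))
    (fun w => Sum.inr (Sum.inr w))

theorem splitProj_splitIncl (x : (J ⊕ J) ⊕ (↥Jᶜ ⊕ W)) : splitProj J (splitIncl J x) = x := by
  rcases x with (⟨y, h⟩ | ⟨y, h⟩) | (⟨y, h⟩ | w)
  · simp [splitProj, splitIncl, h]
  · simp [splitProj, splitIncl, h]
  · have h' : y ∉ J := h
    simp [splitProj, splitIncl, h']
  · simp [splitProj, splitIncl]

/-- The equivalence relations that are invariant under the involution of `(Y ⊕ Y) ⊕ W`. -/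
def IsSwapInvariant (Q : Setoid ((Y ⊕ Y) ⊕ W)) : Prop :=
  ∀ x y, Q x y → Q (Sum.map Sum.swap id x) (Sum.map Sum.swap id y)

/-- The elements of `Y` that are not related to their copy. -/
def separatedSet (Q : Setoid ((Y ⊕ Y) ⊕ W)) : Set Y :=
  {y | ¬ Q (Sum.inl (Sum.inl y)) (Sum.inl (Sum.inr y))}

/-- Together with `splitProj_swap_inr`: the involution descends along `splitProj` to the swap on the
`J`-part and to the identity on the rest, where the two copies are merged. -/
theorem splitProj_swap_inl (x : (Y ⊕ Y) ⊕ W) (z : J ⊕ J) (h : splitProj J x = Sum.inl z) :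
    splitProj J (Sum.map Sum.swap id x) = Sum.inl z.swap := by
  rcases x with (y | y) | w
  · by_cases hy : y ∈ J
    · simp only [splitProj, Sum.elim_inl, hy, dite_true, Sum.inl.injEq] at h
      subst h
      simp [splitProj, hy]
    · simp [splitProj, hy] at h
  · by_cases hy : y ∈ J
    · simp only [splitProj, Sum.elim_inl, Sum.elim_inr, hy, dite_true, Sum.inl.injEq] at h
      subst h
      simp [splitProj, hy]
    · simp [splitProj, hy] at h
  · simp [splitProj] at h

theorem splitProj_swap_inr (x : (Y ⊕ Y) ⊕ W) (z : ↥Jᶜ ⊕ W) (h : splitProj J x = Sum.inr z) :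
    splitProj J (Sum.map Sum.swap id x) = Sum.inr z := by
  rcases x with (y | y) | w
  · by_cases hy : y ∈ J
    · simp [splitProj, hy] at h
    · simp only [splitProj, Sum.elim_inl, hy, dite_false, Sum.inr.injEq] at h
      subst h
      simp [splitProj, hy]
  · by_cases hy : y ∈ J
    · simp [splitProj, hy] at h
    · simp only [splitProj, Sum.elim_inl, Sum.elim_inr, hy, dite_false, Sum.inr.injEq] at h
      subst h
      simp [splitProj, hy]
  · simpa [splitProj] using h

/-- An invariant equivalence relation with given set of separated pairs from its two parts. -/
noncomputable def splitSetoid (P : Setoid (J ⊕ J) × Setoid (↥Jᶜ ⊕ W)) : Setoid ((Y ⊕ Y) ⊕ W) :=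
  (sumSetoid P.1 P.2).comap (splitProj J)

theorem splitSetoid_injective : Function.Injective (splitSetoid (W := W) J) := by
  intro P Q h
  have h' : sumSetoid P.1 P.2 = sumSetoid Q.1 Q.2 :=
    Setoid.comap_injective (splitProj J) (fun x => ⟨_, splitProj_splitIncl J x⟩) h
  have key : ∀ x y, sumSetoid P.1 P.2 x y ↔ sumSetoid Q.1 Q.2 x y := fun x y => by rw [h']
  refine Prod.ext ?_ ?_
  · ext x y
    simpa [sumSetoid_rel, Quotient.eq] using key (Sum.inl x) (Sum.inl y)
  · ext x y
    simpa [sumSetoid_rel, Quotient.eq] using key (Sum.inr x) (Sum.inr y)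

theorem isSwapInvariant_splitSetoid (P : Setoid (J ⊕ J) × Setoid (↥Jᶜ ⊕ W))
    (hP : IsOrthogonal P.1) :
    IsSwapInvariant (splitSetoid J P) ∧ separatedSet (splitSetoid J P) = J := by
  constructor
  · intro x y
    change sumSetoid P.1 P.2 (splitProj J x) (splitProj J y) → sumSetoid P.1 P.2
      (splitProj J (Sum.map Sum.swap id x)) (splitProj J (Sum.map Sum.swap id y))
    rcases hx : splitProj J x with x' | x' <;> rcases hy : splitProj J y with y' | y'
    · rw [splitProj_swap_inl J x x' hx, splitProj_swap_inl J y y' hy]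
      simpa [sumSetoid_rel, Quotient.eq] using hP.1 x' y'
    · simp [sumSetoid_rel]
    · simp [sumSetoid_rel]
    · rw [splitProj_swap_inr J x x' hx, splitProj_swap_inr J y y' hy]
      exact id
  · ext y
    rw [separatedSet, Set.mem_ofPred_eq, splitSetoid, Setoid.comap_rel, sumSetoid_rel]
    by_cases hy : y ∈ J
    · simpa [splitProj, hy, Quotient.eq] using hP.2 (Sum.inl ⟨y, hy⟩)
    · simp [splitProj, hy]

theorem exists_splitSetoid_eq (Q : Setoid ((Y ⊕ Y) ⊕ W)) (hQ : IsSwapInvariant Q)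
    (hJ : separatedSet Q = J) :
    ∃ P : Setoid (J ⊕ J) × Setoid (↥Jᶜ ⊕ W), IsOrthogonal P.1 ∧ splitSetoid J P = Q := by
  have hmem : ∀ y, y ∈ J ↔ ¬ Q (Sum.inl (Sum.inl y)) (Sum.inl (Sum.inr y)) := by
    intro y; rw [← hJ]; rfl
  have hfix : ∀ v : ↥Jᶜ ⊕ W, Q (splitIncl J (Sum.inr v))
      (Sum.map Sum.swap id (splitIncl J (Sum.inr v))) := by
    rintro (⟨y, hy⟩ | w)
    · exact not_not.1 fun h => hy ((hmem y).2 h)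
    · exact Q.refl' _
  have hswap : ∀ x : J ⊕ J, Sum.map Sum.swap id (splitIncl J (Sum.inl x)) =
      splitIncl (W := W) J (Sum.inl x.swap) := by
    rintro (x | x) <;> rfl
  have hsep : ∀ x : J ⊕ J, ¬ Q (splitIncl J (Sum.inl x)) (splitIncl J (Sum.inl x.swap)) := by
    rintro (⟨y, hy⟩ | ⟨y, hy⟩) h
    · exact (hmem y).1 hy h
    · exact (hmem y).1 hy (Q.symm' h)
  -- If a separated `x` were related to some `v` in the rest, the involution would give `x' ~ v' ~ v
  -- ~ x`, against separation.
  have hcross : ∀ x v, ¬ (Q.comap (splitIncl J)) (Sum.inl x) (Sum.inr v) := by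
    intro x v h
    rw [Setoid.comap_rel] at h
    have h' := hQ _ _ h
    rw [hswap] at h'
    exact hsep x (Q.trans' h (Q.trans' (hfix v) (Q.symm' h')))
  refine ⟨⟨(Q.comap (splitIncl J)).comap Sum.inl, (Q.comap (splitIncl J)).comap Sum.inr⟩,
    ⟨fun x y h => ?_, fun x h => hsep x h⟩, ?_⟩
  · have := hQ _ _ h
    rwa [hswap, hswap] at this
  · rw [splitSetoid, sumSetoid_comap _ hcross]
    have hret : ∀ x, Q x (splitIncl J (splitProj J x)) := by
      rintro ((y | y) | w)
      · by_cases hy : y ∈ J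
        · simp [splitProj, splitIncl, hy]
        · simp [splitProj, splitIncl, hy]
      · by_cases hy : y ∈ J
        · simp [splitProj, splitIncl, hy]
        · simpa [splitProj, splitIncl, hy] using Q.symm' (not_not.1 fun h => hy ((hmem y).2 h))
      · simp [splitProj, splitIncl]
    ext x y
    rw [Setoid.comap_rel, Setoid.comap_rel]
    exact ⟨fun h => Q.trans' (hret x) (Q.trans' h (Q.symm' (hret y))),
      fun h => Q.trans' (Q.symm' (hret x)) (Q.trans' h (hret y))⟩

theorem natCard_isSwapInvariant_separatedSet [Finite Y] [Finite W] (k : ℕ) :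
    Nat.card {Q : Setoid ((Y ⊕ Y) ⊕ W) //
        (IsSwapInvariant Q ∧ Nat.card (Quotient Q) = k) ∧ separatedSet Q = J} =
      Nat.card {P : Setoid (J ⊕ J) × Setoid (↥Jᶜ ⊕ W) //
        IsOrthogonal P.1 ∧ Nat.card (Quotient P.1) + Nat.card (Quotient P.2) = k} := by
  have hcard : ∀ P, Nat.card (Quotient (splitSetoid (W := W) J P)) =
      Nat.card (Quotient P.1) + Nat.card (Quotient P.2) := by
    intro P
    rw [splitSetoid, natCard_quotient_comap _ fun x => ⟨_, splitProj_splitIncl J x⟩,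
      natCard_quotient_sumSetoid]
  symm
  refine Nat.card_congr (Equiv.ofBijective (fun P => ⟨splitSetoid J P.1,
    ⟨(isSwapInvariant_splitSetoid J P.1 P.2.1).1, (hcard _).trans P.2.2⟩,
    (isSwapInvariant_splitSetoid J P.1 P.2.1).2⟩) ⟨fun P Q h => ?_, fun Q => ?_⟩)
  · exact Subtype.ext (splitSetoid_injective J (congrArg Subtype.val h))
  · obtain ⟨P, hP, hPQ⟩ := exists_splitSetoid_eq J Q.1 Q.2.1.1 Q.2.2
    exact ⟨⟨P, hP, by rw [← hcard, hPQ]; exact Q.2.1.2⟩, Subtype.ext hPQ⟩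

end Split

/-- The number of partitions into `k` blocks of a set with an involution, with `ζ` exchanged pairs
and `m` fixed points, that are invariant under the involution. -/
noncomputable def invariantPartitionCount (ζ m k : ℕ) : ℕ :=
  ∑ j ∈ Finset.range (ζ + 1), ζ.choose j *
    ∑ t ∈ Finset.range (min j ((k - 1) / 2) + 1),
      orthogonalSelfDualCount j t * Nat.stirlingSecond (ζ - j + m) (k - 2 * t)

/-- The invariant partitions are sorted by their separated set `J`; the count for `J` depends only
on its size `j`, which produces the binomial coefficient. -/
theorem natCard_isSwapInvariant (Y W : Type*) [Finite Y] [Finite W] [Nonempty W] (k : ℕ) :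
    Nat.card {Q : Setoid ((Y ⊕ Y) ⊕ W) // IsSwapInvariant Q ∧ Nat.card (Quotient Q) = k} =
      invariantPartitionCount (Nat.card Y) (Nat.card W) k := by
  classical
  have := Fintype.ofFinite Y
  have := Fintype.ofFinite (Setoid ((Y ⊕ Y) ⊕ W))
  have h1 : Nat.card {Q : Setoid ((Y ⊕ Y) ⊕ W) // IsSwapInvariant Q ∧ Nat.card (Quotient Q) = k} =
      ∑ J : Finset Y, Nat.card {Q : Setoid ((Y ⊕ Y) ⊕ W) //
        (IsSwapInvariant Q ∧ Nat.card (Quotient Q) = k) ∧ separatedSet Q = (J : Set Y)} := by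
    simp only [natCard_subtype_eq_sum]
    rw [Finset.sum_comm]
    refine Finset.sum_congr rfl fun Q _ => ?_
    rw [Finset.sum_eq_single (separatedSet Q).toFinset]
    · simp
    · intro J _ hJ
      refine if_neg fun h => hJ ?_
      ext y
      rw [Set.mem_toFinset, h.2, Finset.mem_coe]
    · simp
  rw [h1, invariantPartitionCount]
  simp only [natCard_isSwapInvariant_separatedSet, natCard_isOrthogonal_prod]
  have h2 := Finset.sum_powerset_apply_card (x := (Finset.univ : Finset Y)) (fun j =>
    ∑ t ∈ Finset.range (min j ((k - 1) / 2) + 1),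
      orthogonalSelfDualCount j t *
        Nat.stirlingSecond (Nat.card Y - j + Nat.card W) (k - 2 * t))
  rw [Finset.powerset_univ, Finset.card_univ, ← Nat.card_eq_fintype_card] at h2
  simp only [smul_eq_mul] at h2
  rw [← h2]
  refine Finset.sum_congr rfl fun J _ => ?_
  have h3 : Nat.card ((J : Set Y)ᶜ : Set Y) = Nat.card Y - J.card := by
    rw [Nat.card_coe_set_eq, ← Finset.coe_compl, Set.ncard_coe_finset, Finset.card_compl,
      Nat.card_eq_fintype_card]
  rw [Nat.card_sum, h3]
  simp

/-- Invariant partitions of an arbitrary finite set with an involution. -/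
theorem natCard_setoid_invariant {Z : Type*} [Finite Z] {θ : Z → Z} (hθ : Function.Involutive θ)
    {ζ m : ℕ} (hm : m ≠ 0) (hfix : Nat.card {z // θ z = z} = m) (hZ : Nat.card Z = 2 * ζ + m)
    (k : ℕ) :
    Nat.card {Q : Setoid Z // (∀ x y, Q x y → Q (θ x) (θ y)) ∧ Nat.card (Quotient Q) = k} =
      invariantPartitionCount ζ m k := by
  obtain ⟨Y, _, e, he⟩ := hθ.exists_equiv_sum
  have : Nonempty {z // θ z = z} := (Nat.card_ne_zero.1 (hfix.trans_ne hm)).1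
  have hY : Nat.card Y = ζ := by
    have := Nat.card_congr e
    rw [Nat.card_sum, Nat.card_sum] at this
    omega
  rw [← hfix, ← hY, ← natCard_isSwapInvariant]
  refine Nat.card_congr ((setoidCongr e).subtypeEquiv fun Q => ?_)
  rw [setoidCongr, Equiv.coe_fn_mk, natCard_quotient_comap _ e.surjective]
  refine and_congr ⟨fun h x y hxy => ?_, fun h x y hxy => ?_⟩ Iff.rfl
  · have := h _ _ hxy
    rwa [he, he] at this
  · have := h (e.symm x) (e.symm y) (by simpa [Setoid.comap_rel] using hxy)
    rw [Setoid.comap_rel, ← he, ← he] at this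
    simpa using this

/-! ### Orbits that are fixed by a map commuting with a group action -/

section CosetBurnside

variable {G X : Type*} [Group G] [MulAction G X]

theorem natCard_smul_eq_of_mem_orbit {x₀ y : X} (hy : y ∈ MulAction.orbit G x₀) (x : X) :
    Nat.card {g : G // g • y = x} = Nat.card {g : G // g • x₀ = x} := by
  obtain ⟨b, rfl⟩ := hy
  exact Nat.card_congr ((Equiv.mulRight b).subtypeEquiv fun g => by simp [mul_smul])

/-- As `τ x` stays in the orbit, right translation in `G` replaces it by the base point `x₀`. Each
`g` is then counted once, at `x = g • x₀`. -/
theorem sum_orbit_natCard_smul_eq [Finite G] (S : Finset X) (x₀ : X)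
    (hS : ∀ x, x ∈ S ↔ x ∈ MulAction.orbit G x₀) (τ : X → X)
    (hτ : ∀ x ∈ MulAction.orbit G x₀, τ x ∈ MulAction.orbit G x₀) :
    ∑ x ∈ S, Nat.card {g : G // g • τ x = x} = Nat.card G := by
  classical
  have := Fintype.ofFinite G
  rw [Finset.sum_congr rfl fun x hx =>
    natCard_smul_eq_of_mem_orbit (hτ x ((hS x).1 hx)) x]
  simp only [natCard_subtype_eq_sum]
  rw [Finset.sum_comm, Nat.card_eq_fintype_card, ← Finset.card_univ, Finset.card_eq_sum_ones]
  refine Finset.sum_congr rfl fun g _ => ?_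
  rw [Finset.sum_ite_eq, if_pos ((hS _).2 ⟨g, rfl⟩)]

theorem map_mem_orbit {τ : X → X} (hτ : ∀ (g : G) x, τ (g • x) = g • τ x) {x₀ : X}
    (h : τ x₀ ∈ MulAction.orbit G x₀) : ∀ x ∈ MulAction.orbit G x₀, τ x ∈ MulAction.orbit G x₀ := by
  rintro _ ⟨g, rfl⟩
  simp only [hτ]
  obtain ⟨k, hk⟩ := h
  exact ⟨g * k, by simp only [mul_smul] at hk ⊢; rw [hk]⟩

/-- A form of Burnside's lemma for a coset: counting the orbits that are mapped to themselves. -/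
theorem sum_natCard_smul_eq [Finite G] [Fintype X] {τ : X → X}
    (hτ : ∀ (g : G) x, τ (g • x) = g • τ x)
    (θ : MulAction.orbitRel.Quotient G X → MulAction.orbitRel.Quotient G X)
    (hθ : ∀ x, θ (Quotient.mk _ x) = Quotient.mk _ (τ x)) :
    ∑ x, Nat.card {g : G // g • τ x = x} = Nat.card {z // θ z = z} * Nat.card G := by
  classical
  have := Fintype.ofFinite (MulAction.orbitRel.Quotient G X)
  rw [natCard_subtype_eq_sum, Finset.sum_mul,
    ← Finset.sum_fiberwise_of_maps_to (s := Finset.univ) (t := Finset.univ)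
      (g := fun x : X => (Quotient.mk _ x : MulAction.orbitRel.Quotient G X))
      (fun _ _ => Finset.mem_univ _)]
  refine Finset.sum_congr rfl fun z _ => ?_
  induction z using Quotient.inductionOn with
  | h x₀ =>
    have hS : ∀ x, x ∈ Finset.univ.filter (fun x : X =>
        (Quotient.mk _ x : MulAction.orbitRel.Quotient G X) = Quotient.mk _ x₀) ↔
        x ∈ MulAction.orbit G x₀ := by
      intro x
      rw [Finset.mem_filter, and_iff_right (Finset.mem_univ x), Quotient.eq,
        MulAction.orbitRel_apply]
    have h0 : θ (Quotient.mk _ x₀) = Quotient.mk _ x₀ ↔ τ x₀ ∈ MulAction.orbit G x₀ := by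
      rw [hθ, Quotient.eq, MulAction.orbitRel_apply]
    split_ifs with h
    · rw [one_mul, sum_orbit_natCard_smul_eq _ x₀ hS τ (map_mem_orbit hτ (h0.1 h))]
    · rw [zero_mul]
      refine Finset.sum_eq_zero fun x hx => ?_
      rw [Nat.card_eq_zero]
      refine Or.inl ⟨fun ⟨g, hg⟩ => h ?_⟩
      rw [← (Finset.mem_filter.1 hx).2, hθ, Quotient.eq, MulAction.orbitRel_apply]
      exact ⟨g⁻¹, inv_smul_eq_iff.2 hg.symm⟩

end CosetBurnside

theorem sum_zpowers_eq_sum_range {G M : Type*} [Group G] [Finite G] [AddCommMonoid M] (a : G)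
    [Fintype (Subgroup.zpowers a)] (f : G → M) :
    ∑ h : Subgroup.zpowers a, f h = ∑ k ∈ Finset.range (orderOf a), f (a ^ k) := by
  rw [← Fin.sum_univ_eq_sum_range (fun k => f (a ^ k)) (orderOf a)]
  exact (Fintype.sum_equiv (finEquivZPowers (isOfFinOrder_of_finite a)) _ _ fun k => by
    simp [finEquivZPowers_apply]).symm

/-- The coset Burnside lemma for the cyclic group generated by `a`. With `τ` the identity it counts
all orbits, with `τ` the twist those fixed by the involution. -/
theorem sum_range_natCard_pow_eq {E : Type*} [Finite E] (a : Equiv.Perm E) (τ : E → E)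
    (hτ : ∀ x, τ (a x) = a (τ x))
    (θ : MulAction.orbitRel.Quotient (Subgroup.zpowers a) E →
      MulAction.orbitRel.Quotient (Subgroup.zpowers a) E)
    (hθ : ∀ x, θ (Quotient.mk _ x) = Quotient.mk _ (τ x)) :
    ∑ k ∈ Finset.range (orderOf a), Nat.card {x // (a ^ k) (τ x) = x} =
      Nat.card {z // θ z = z} * orderOf a := by
  classical
  have := Fintype.ofFinite E
  have := Fintype.ofFinite (Subgroup.zpowers a)
  have hτ' : ∀ (g : Subgroup.zpowers a) x, τ (g • x) = g • τ x := by
    rintro ⟨g, hg⟩ x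
    change τ (g x) = g (τ x)
    obtain ⟨k, rfl⟩ := mem_powers_iff_mem_zpowers.2 hg
    simp only
    induction k generalizing x with
    | zero => rfl
    | succ k ih => rw [pow_succ', Equiv.Perm.mul_apply, Equiv.Perm.mul_apply, hτ,
        ih _ (Subgroup.npow_mem_zpowers a k)]
  have := sum_natCard_smul_eq hτ' θ hθ
  rw [Nat.card_zpowers] at this
  rw [← this, ← sum_zpowers_eq_sum_range a fun h => Nat.card {x // h (τ x) = x}]
  simp only [natCard_subtype_eq_sum]
  rw [Finset.sum_comm]
  rfl

/-! ### Fixed points of powers of a permutation -/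

/-- A point of a cycle of length `l` is fixed by `σ ^ m` exactly when `l ∣ m`, so each cycle
contributes all of its points or none. -/
theorem Equiv.Perm.natCard_pow_fixed {A : Type*} [Fintype A] [DecidableEq A] (σ : Equiv.Perm A)
    (m : ℕ) : Nat.card {a // (σ ^ m) a = a} =
      (σ.partition.parts.map fun l => if l ∣ m then l else 0).sum := by
  rw [natCard_subtype_eq_sum, Equiv.Perm.parts_partition, Multiset.map_add, Multiset.sum_add,
    ← Finset.sum_add_sum_compl σ.support]
  congr 1
  · rw [Equiv.Perm.cycleType_def, Multiset.map_map,
      ← Finset.sum_fiberwise_of_maps_to (t := σ.cycleFactorsFinset) (g := fun a => σ.cycleOf a)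
        fun a ha => Equiv.Perm.cycleOf_mem_cycleFactorsFinset_iff.2 ha]
    refine Finset.sum_congr rfl fun c hc => ?_
    have hcyc := (Equiv.Perm.mem_cycleFactorsFinset_iff.1 hc).1
    have hfib : σ.support.filter (fun a => σ.cycleOf a = c) = c.support := by
      ext a
      rw [Finset.mem_filter]
      constructor
      · rintro ⟨ha, rfl⟩
        rw [Equiv.Perm.mem_support_cycleOf_iff]
        exact ⟨Equiv.Perm.SameCycle.refl _ _, ha⟩
      · intro ha
        exact ⟨Equiv.Perm.mem_cycleFactorsFinset_support_le hc ha,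
          (Equiv.Perm.cycle_is_cycleOf ha hc).symm⟩
    rw [hfib]
    have hval : ∀ a ∈ c.support, ((σ ^ m) a = a ↔ c.support.card ∣ m) := by
      intro a ha
      rw [← hcyc.orderOf, orderOf_dvd_iff_pow_eq_one,
        hcyc.pow_eq_one_iff' (Equiv.Perm.mem_support.1 ha)]
      rw [Equiv.Perm.cycle_is_cycleOf ha hc, Equiv.Perm.cycleOf_pow_apply_self]
    rw [Finset.sum_congr rfl fun a ha => if_congr (hval a ha) rfl rfl]
    simp
  · rw [Multiset.map_replicate, Multiset.sum_replicate]
    rw [Finset.sum_congr rfl fun a ha => if_pos (by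
      have : σ a = a := by simpa using ha
      exact Equiv.Perm.pow_apply_eq_self_of_apply_eq_self this m)]
    simp [Finset.card_compl]

theorem sum_map_parts_eq_sum_get {r : ℕ} (lam : r.Partition) (f : ℕ → ℕ) :
    (lam.parts.map f).sum = ∑ i : Fin (partitionList lam).length, f ((partitionList lam).get i) := by
  have : lam.parts = (partitionList lam : Multiset ℕ) := (Multiset.sort_eq _ _).symm
  rw [this, Multiset.map_coe, Multiset.sum_coe]
  simp

/-! ### Arithmetic of cycle lengths -/

theorem card_range_dvd_mul {c d : ℕ} (h : c ∣ d) :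
    ((Finset.range d).filter fun k => c ∣ k).card * c = d := by
  obtain ⟨q, rfl⟩ := h
  rcases Nat.eq_zero_or_pos c with rfl | hc
  · simp
  · have := Nat.count_modEq_card (c * q) hc 0
    rw [Nat.count_eq_card_filter_range] at this
    simp only [Nat.modEq_zero_iff_dvd] at this
    rw [this]
    simp [hc, mul_comm]

/-- Both divisibilities say that the lcm divides `2k`. An odd lcm must divide `k`; an even one only
needs its half to divide `k`, which happens twice as often. With `l m = gcd · lcm` this yields the
factor `1 + e_{ij}`. -/
theorem mul_mul_sum_dvd {l m d : ℕ} (hl : l ∣ 2 * d) (hm : m ∣ 2 * d) :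
    ∑ k ∈ Finset.range d, (if l ∣ 2 * k then l else 0) * (if m ∣ 2 * k then m else 0) =
      (1 + evenInd₂ l m) * Nat.gcd l m * d := by
  have hlcm : l * m = Nat.gcd l m * Nat.lcm l m := (Nat.gcd_mul_lcm l m).symm
  have h1 : ∀ k, (if l ∣ 2 * k then l else 0) * (if m ∣ 2 * k then m else 0) =
      l * m * if Nat.lcm l m ∣ 2 * k then 1 else 0 := by
    intro k
    simp only [Nat.lcm_dvd_iff]
    split_ifs <;> simp_all
  have hd := Nat.lcm_dvd hl hm
  simp only [h1]
  rw [← Finset.mul_sum, ← Finset.card_filter, hlcm]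
  by_cases hev : l % 2 = 0 ∨ m % 2 = 0
  · have h2 : 2 ∣ Nat.lcm l m := by
      rcases hev with h | h
      · exact (Nat.dvd_of_mod_eq_zero h).trans (Nat.dvd_lcm_left _ _)
      · exact (Nat.dvd_of_mod_eq_zero h).trans (Nat.dvd_lcm_right _ _)
    obtain ⟨c, hc⟩ := h2
    rw [hc] at hd ⊢
    simp only [Nat.mul_dvd_mul_iff_left (two_pos)] at hd ⊢
    have := card_range_dvd_mul hd
    rw [evenInd₂, if_pos hev]
    linear_combination 2 * Nat.gcd l m * this
  · have hodd : Nat.Coprime (Nat.lcm l m) 2 := by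
      push Not at hev
      refine Nat.Coprime.of_dvd_left (Nat.lcm_dvd_mul l m) (Nat.Coprime.mul_left ?_ ?_)
      · rw [Nat.coprime_comm, Nat.coprime_two_left]; exact Nat.odd_iff.2 (by omega)
      · rw [Nat.coprime_comm, Nat.coprime_two_left]; exact Nat.odd_iff.2 (by omega)
    simp only [hodd.dvd_mul_left] at hd ⊢
    have := card_range_dvd_mul hd
    rw [evenInd₂, if_neg hev]
    linear_combination Nat.gcd l m * this

theorem card_range_odd_dvd_mul {c d : ℕ} (hodd : c % 2 = 1) (h : c ∣ d) :
    ((Finset.range d).filter fun k => c ∣ 2 * k + 1).card * c = d := by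
  obtain ⟨q, rfl⟩ := h
  have hc : 0 < c := by omega
  -- For odd `c`, `c = 2 (c / 2) + 1`, and 2 is cancellable modulo `c`: the condition is a single
  -- residue class.
  have key : ∀ k, c ∣ 2 * k + 1 ↔ k ≡ c / 2 [MOD c] := by
    intro k
    have h2 : Nat.Coprime c 2 := by
      rw [Nat.coprime_comm, Nat.coprime_two_left]; exact Nat.odd_iff.2 hodd
    have h3 : 2 * (c / 2) + 1 = c := by omega
    rw [← Nat.modEq_zero_iff_dvd]
    constructor
    · intro h
      have : 2 * k + 1 ≡ 2 * (c / 2) + 1 [MOD c] := by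
        rw [h3]; exact h.trans (by simp [Nat.ModEq])
      exact Nat.ModEq.cancel_left_of_coprime h2 (Nat.ModEq.add_right_cancel' 1 this)
    · intro h
      have : 2 * k + 1 ≡ 2 * (c / 2) + 1 [MOD c] := (h.mul_left 2).add_right 1
      rw [h3] at this
      exact this.trans (by simp [Nat.ModEq])
  have := Nat.count_modEq_card (c * q) hc (c / 2)
  rw [Nat.count_eq_card_filter_range] at this
  simp only [key]
  rw [this]
  simp [hc, mul_comm]

/-- An odd `l` must divide `2k + 1`, giving `d` in total. If `l = 2q` with `q` odd, then `q` must,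
giving `2d`. If `4 ∣ l`, no `k` qualifies. -/
theorem sum_odd_dvd {l d : ℕ} (hl : l ∣ 2 * d) :
    ∑ k ∈ Finset.range d, (if l ∣ 2 * (2 * k + 1) then l else 0) =
      (1 - evenInd l + 2 * twiceOddInd l) * d := by
  rw [← Finset.sum_filter, Finset.sum_const, smul_eq_mul, evenInd, twiceOddInd]
  rcases Nat.even_or_odd' l with ⟨q, rfl | rfl⟩
  · rw [if_pos (by omega)]
    simp only [Nat.mul_dvd_mul_iff_left (two_pos)] at hl ⊢
    rcases Nat.mod_two_eq_zero_or_one q with hq | hq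
    · rw [if_neg (by omega), Finset.filter_false_of_mem]
      · simp
      · intro k _ h
        have := (Nat.dvd_of_mod_eq_zero hq).trans h
        omega
    · rw [if_pos (by omega)]
      have := card_range_odd_dvd_mul hq hl
      linear_combination 2 * this
  · have h2 : Nat.Coprime (2 * q + 1) 2 := by simp
    simp only [h2.dvd_mul_left] at hl ⊢
    rw [if_neg (by omega), if_neg (by omega), card_range_odd_dvd_mul (by omega) hl]
    simp

/-! ### The twisted action of a permutation on pairs -/

section PairTwist

variable {A : Type*}

/-- The permutation `(a, b) ↦ (σ b, σ a)` of the pairs, with an additional fixed point. -/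
def pairTwist (σ : Equiv.Perm A) : Equiv.Perm (Option (A × A)) :=
  Equiv.optionCongr ((Equiv.prodComm A A).trans (σ.prodCongr σ))

theorem pairTwist_none (σ : Equiv.Perm A) : pairTwist σ none = none := rfl

theorem pairTwist_some (σ : Equiv.Perm A) (a b : A) :
    pairTwist σ (some (a, b)) = some (σ b, σ a) := rfl

theorem pairTwist_sq_pow_none (σ : Equiv.Perm A) (k : ℕ) :
    ((pairTwist σ ^ 2) ^ k) none = none := by
  induction k with
  | zero => rfl
  | succ k ih => rw [pow_succ', Equiv.Perm.mul_apply, ih]; rfl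

theorem pairTwist_sq_pow_some (σ : Equiv.Perm A) (k : ℕ) (a b : A) :
    ((pairTwist σ ^ 2) ^ k) (some (a, b)) = some ((σ ^ (2 * k)) a, (σ ^ (2 * k)) b) := by
  induction k with
  | zero => rfl
  | succ k ih =>
    rw [pow_succ', Equiv.Perm.mul_apply, ih, Nat.mul_succ, add_comm, pow_add]
    rfl

theorem natCard_subtype_option {X : Type*} [Finite X] (p : Option X → Prop) (hp : p none) :
    Nat.card {x // p x} = 1 + Nat.card {x : X // p (some x)} := by
  classical
  have := Fintype.ofFinite X
  rw [natCard_subtype_eq_sum, natCard_subtype_eq_sum, Fintype.sum_option, if_pos hp]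

theorem natCard_pairTwist_sq_pow_fixed [Finite A] (σ : Equiv.Perm A) (k : ℕ) :
    Nat.card {x // ((pairTwist σ ^ 2) ^ k) x = x} =
      1 + Nat.card {a // (σ ^ (2 * k)) a = a} * Nat.card {a // (σ ^ (2 * k)) a = a} := by
  rw [natCard_subtype_option (fun x => ((pairTwist σ ^ 2) ^ k) x = x)
    (pairTwist_sq_pow_none σ k), ← Nat.card_prod]
  congr 1
  refine Nat.card_congr (Equiv.trans (Equiv.subtypeEquivRight ?_) Equiv.subtypeProdEquivProd)
  rintro ⟨a, b⟩
  rw [pairTwist_sq_pow_some, Option.some.injEq, Prod.mk.injEq]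

/-- A pair fixed by an odd power of the twist is determined by its first component `a`: the second
is `σ ^ (2k+1) a`, and a second application must return to `a`. -/
theorem natCard_pairTwist_odd_pow_fixed [Finite A] (σ : Equiv.Perm A) (k : ℕ) :
    Nat.card {x // ((pairTwist σ ^ 2) ^ k) (pairTwist σ x) = x} =
      1 + Nat.card {a // (σ ^ (2 * (2 * k + 1))) a = a} := by
  rw [natCard_subtype_option _ (by rw [pairTwist_none, pairTwist_sq_pow_none])]
  congr 1
  have key : ∀ a b : A, ((pairTwist σ ^ 2) ^ k) (pairTwist σ (some (a, b))) = some (a, b) ↔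
      (σ ^ (2 * k + 1)) b = a ∧ (σ ^ (2 * k + 1)) a = b := by
    intro a b
    rw [pairTwist_some, pairTwist_sq_pow_some, Option.some.injEq, Prod.mk.injEq, pow_succ]
    rfl
  have hsq : ∀ a : A, (σ ^ (2 * (2 * k + 1))) a = (σ ^ (2 * k + 1)) ((σ ^ (2 * k + 1)) a) := by
    intro a
    rw [two_mul, pow_add, Equiv.Perm.mul_apply]
  refine Nat.card_congr
    { toFun := fun x => ⟨x.1.1, ?_⟩
      invFun := fun a => ⟨(a.1, (σ ^ (2 * k + 1)) a.1), ?_⟩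
      left_inv := ?_
      right_inv := fun a => rfl }
  · obtain ⟨h1, h2⟩ := (key x.1.1 x.1.2).1 x.2
    rw [hsq, h2, h1]
  · exact (key _ _).2 ⟨by rw [← hsq]; exact a.2, rfl⟩
  · rintro ⟨⟨a, b⟩, h⟩
    exact Subtype.ext (Prod.ext rfl ((key a b).1 h).2)

theorem dvd_of_mem_parts_of_pow_eq_one [Fintype A] [DecidableEq A] (σ : Equiv.Perm A) {m l : ℕ}
    (h : σ ^ m = 1) (hl : l ∈ σ.partition.parts) : l ∣ m := by
  rw [Equiv.Perm.parts_partition, Multiset.mem_add] at hl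
  rcases hl with hl | hl
  · exact (Equiv.Perm.dvd_of_mem_cycleType hl).trans (orderOf_dvd_of_pow_eq_one h)
  · rw [Multiset.eq_of_mem_replicate hl]
    exact one_dvd m

theorem dvd_two_mul_orderOf [Fintype A] [DecidableEq A] (σ : Equiv.Perm A) {l : ℕ}
    (hl : l ∈ σ.partition.parts) : l ∣ 2 * orderOf (pairTwist σ ^ 2) := by
  refine dvd_of_mem_parts_of_pow_eq_one σ (Equiv.ext fun a => ?_) hl
  -- On diagonal pairs the squared twist acts as `σ²`, so its order `d` satisfies `σ ^ (2d) = 1`.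
  have := pairTwist_sq_pow_some σ (orderOf (pairTwist σ ^ 2)) a a
  rw [pow_orderOf_eq_one] at this
  exact (congrArg Prod.fst (Option.some.inj this)).symm

/-- The number `2ζ + η + 1` of orbits of the square of the twist. -/
theorem partition_sum_gcd {r : ℕ} (lam : r.Partition) :
    ∑ i : Fin (partitionList lam).length, ∑ j : Fin (partitionList lam).length,
      (1 + evenInd₂ ((partitionList lam).get i) ((partitionList lam).get j)) *
        Nat.gcd ((partitionList lam).get i) ((partitionList lam).get j) =
      2 * partitionZeta lam + partitionEta lam := by
  set L := partitionList lam with hL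
  set F : Fin L.length → Fin L.length → ℕ := fun i j =>
    (1 + evenInd₂ (L.get i) (L.get j)) * Nat.gcd (L.get i) (L.get j) with hF
  have hsymm : ∀ i j, F i j = F j i := by
    intro i j
    simp only [hF, evenInd₂, or_comm, Nat.gcd_comm]
  have hpos : ∀ i, 0 < L.get i := by
    intro i
    refine lam.parts_pos ?_
    have : L.get i ∈ partitionList lam := List.get_mem _ _
    rwa [partitionList, Multiset.mem_sort] at this
  have hsplit : ∑ i, ∑ j, F i j = ∑ i, F i i + 2 * ∑ i, ∑ j ∈ Finset.Ioi i, F i j := by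
    have h1 : ∀ i, ∑ j, F i j = F i i + ∑ j ∈ Finset.Ioi i, F i j + ∑ j ∈ Finset.Iio i, F i j := by
      intro i
      have h0 : (Finset.univ : Finset (Fin L.length)) =
          insert i (Finset.Ioi i ∪ Finset.Iio i) := by
        ext j
        simp only [Finset.mem_univ, Finset.mem_insert, Finset.mem_union, Finset.mem_Ioi,
          Finset.mem_Iio, true_iff]
        rcases lt_trichotomy i j with h | h | h
        · exact Or.inr (Or.inl h)
        · exact Or.inl h.symm
        · exact Or.inr (Or.inr h)
      rw [h0, Finset.sum_insert (by simp), Finset.sum_union, add_assoc]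
      rw [Finset.disjoint_left]
      intro j h h'
      exact lt_asymm (Finset.mem_Ioi.1 h) (Finset.mem_Iio.1 h')
    have h2 : ∑ i, ∑ j ∈ Finset.Iio i, F i j = ∑ i, ∑ j ∈ Finset.Ioi i, F i j := by
      rw [Finset.sum_comm' (t' := Finset.univ) (s' := fun j => Finset.Ioi j) (by simp)]
      exact Finset.sum_congr rfl fun i _ => Finset.sum_congr rfl fun j _ => hsymm j i
    simp only [h1, Finset.sum_add_distrib]
    rw [h2]
    ring
  let z : ℕ → ℕ := fun l => ((1 + evenInd l) * (l + 1) - 2 * (twiceOddInd l + 1)) / 2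
  let y : ℕ → ℕ := fun l => 1 - evenInd l + 2 * twiceOddInd l
  have hz : ∀ i, (1 + evenInd (L.get i)) * (L.get i + 1) - 2 * (twiceOddInd (L.get i) + 1) =
      2 * z (L.get i) := by
    intro i
    have := hpos i
    simp only [z, evenInd, twiceOddInd]
    split_ifs <;> omega
  -- The three cases are `l = 2·(l-1)/2 + 1` for odd `l`, `2l = 2(l-1) + 2` for `l ≡ 2` mod 4, and
  -- `2l = 2l + 0` for `4 ∣ l`.
  have hdiag : ∀ i, F i i = 2 * z (L.get i) + y (L.get i) := by
    intro i
    have := hpos i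
    simp only [hF, z, y, evenInd, twiceOddInd, evenInd₂, or_self, Nat.gcd_self]
    split_ifs <;> omega
  rw [hsplit, partitionZeta, partitionEta, sum_map_parts_eq_sum_get, sum_map_parts_eq_sum_get]
  change _ = 2 * ((∑ i : Fin L.length, _) / 2 + _) + _
  rw [Finset.sum_congr rfl fun i _ => hz i, ← Finset.mul_sum, Nat.mul_div_cancel_left _ two_pos,
    Finset.sum_congr rfl fun i _ => hdiag i, Finset.sum_add_distrib, ← Finset.mul_sum]
  simp only [hF, y]
  ring

/-- The orbits of the square of the twist. -/
abbrev TwistOrbits (σ : Equiv.Perm A) : Type _ :=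
  MulAction.orbitRel.Quotient (Subgroup.zpowers (pairTwist σ ^ 2)) (Option (A × A))

/-- The involution that the twist induces on the orbits of its square. -/
def twistInvolution (σ : Equiv.Perm A) : TwistOrbits σ → TwistOrbits σ :=
  Quotient.map (pairTwist σ) fun x y h => by
    obtain ⟨⟨h, k, rfl⟩, rfl⟩ := h
    refine ⟨⟨(pairTwist σ ^ 2) ^ k, k, rfl⟩, ?_⟩
    change ((pairTwist σ ^ 2) ^ k * pairTwist σ) y = (pairTwist σ * (pairTwist σ ^ 2) ^ k) y
    rw [(((Commute.refl (pairTwist σ)).pow_left 2).zpow_left k).eq]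

theorem twistInvolution_involutive (σ : Equiv.Perm A) :
    Function.Involutive (twistInvolution σ) := by
  intro z
  induction z using Quotient.inductionOn with
  | h x => exact Quotient.sound ⟨⟨pairTwist σ ^ 2, Subgroup.mem_zpowers _⟩, rfl⟩

/-- The Burnside sum runs over the odd powers of the twist; each cycle contributes its summand of
`η`, and the point `none` contributes the extra 1. -/
theorem natCard_twistOrbits_fixed [Fintype A] [DecidableEq A] (σ : Equiv.Perm A) {r : ℕ}
    (lam : r.Partition) (hlam : lam.parts = σ.partition.parts) :
    Nat.card {z // twistInvolution σ z = z} = partitionEta lam + 1 := by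
  have h := sum_range_natCard_pow_eq (pairTwist σ ^ 2) (pairTwist σ) (fun x => rfl)
    (twistInvolution σ) (fun x => rfl)
  refine Nat.eq_of_mul_eq_mul_right (orderOf_pos (pairTwist σ ^ 2)) (h.symm.trans ?_)
  simp only [natCard_pairTwist_odd_pow_fixed, Equiv.Perm.natCard_pow_fixed, ← hlam]
  simp only [sum_map_parts_eq_sum_get, Finset.sum_add_distrib]
  rw [Finset.sum_comm, partitionEta, sum_map_parts_eq_sum_get, add_mul, Finset.sum_mul, add_comm]
  congr 1
  · refine Finset.sum_congr rfl fun i _ => sum_odd_dvd (dvd_two_mul_orderOf σ ?_)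
    rw [← hlam]
    exact (Multiset.mem_sort _).1 (List.get_mem (partitionList lam) i)
  · simp

theorem natCard_twistOrbits [Fintype A] [DecidableEq A] (σ : Equiv.Perm A) {r : ℕ}
    (lam : r.Partition) (hlam : lam.parts = σ.partition.parts) :
    Nat.card (TwistOrbits σ) = 2 * partitionZeta lam + (partitionEta lam + 1) := by
  have h := sum_range_natCard_pow_eq (pairTwist σ ^ 2) id (fun x => rfl) id (fun x => rfl)
  simp only [id] at h
  rw [Nat.card_congr (Equiv.subtypeUnivEquiv fun _ => trivial)] at h
  simp only [natCard_pairTwist_sq_pow_fixed] at h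
  simp only [Equiv.Perm.natCard_pow_fixed σ, ← hlam] at h
  refine Nat.eq_of_mul_eq_mul_right (orderOf_pos (pairTwist σ ^ 2)) (h.symm.trans ?_)
  simp only [sum_map_parts_eq_sum_get, Finset.sum_add_distrib, Finset.sum_mul_sum]
  rw [← add_assoc, ← partition_sum_gcd, add_mul, Finset.sum_comm, Finset.sum_mul, add_comm]
  have hmem : ∀ i, (partitionList lam).get i ∣ 2 * orderOf (pairTwist σ ^ 2) := fun i =>
    dvd_two_mul_orderOf σ (by
      rw [← hlam]; exact (Multiset.mem_sort _).1 (List.get_mem (partitionList lam) i))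
  congr 1
  · refine Finset.sum_congr rfl fun i _ => ?_
    rw [Finset.sum_comm, Finset.sum_mul]
    refine Finset.sum_congr rfl fun j _ => ?_
    rw [← mul_mul_sum_dvd (hmem i) (hmem j)]
  · simp

/-- The twist of `σ` maps blocks to blocks, and its square fixes every block. -/
def IsTwistInvariant (σ : Equiv.Perm A) (P : Setoid (Option (A × A))) : Prop :=
  (∀ x y, P x y → P (pairTwist σ x) (pairTwist σ y)) ∧ ∀ x, P x (pairTwist σ (pairTwist σ x))

theorem IsTwistInvariant.rel_of_orbitRel [Finite A] {σ : Equiv.Perm A}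
    {P : Setoid (Option (A × A))} (hP : IsTwistInvariant σ P) {x y : Option (A × A)}
    (h : MulAction.orbitRel (Subgroup.zpowers (pairTwist σ ^ 2)) (Option (A × A)) x y) : P x y := by
  obtain ⟨⟨h, hh⟩, rfl⟩ := h
  obtain ⟨k, rfl⟩ := mem_powers_iff_mem_zpowers.2 hh
  refine P.symm' ?_
  change P y (((pairTwist σ ^ 2) ^ k) y)
  clear hh
  induction k with
  | zero => exact P.refl' y
  | succ k ih =>
    rw [pow_succ', Equiv.Perm.mul_apply]
    exact P.trans' ih (hP.2 _)

/-- When the squared twist fixes every block, the blocks are unions of its orbits, so `P` is the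
pullback of a unique partition of the orbit set; invariance under the twist becomes invariance under
the involution. -/
theorem natCard_isTwistInvariant [Fintype A] [DecidableEq A] (σ : Equiv.Perm A) {r : ℕ}
    (lam : r.Partition) (hlam : lam.parts = σ.partition.parts) (k : ℕ) :
    Nat.card {P : Setoid (Option (A × A)) // IsTwistInvariant σ P ∧ Nat.card (Quotient P) = k} =
      invariantPartitionCount (partitionZeta lam) (partitionEta lam + 1) k := by
  rw [← natCard_setoid_invariant (twistInvolution_involutive σ) (Nat.succ_ne_zero _)
    (natCard_twistOrbits_fixed σ lam hlam) (natCard_twistOrbits σ lam hlam)]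
  symm
  have hmk : Function.Surjective (Quotient.mk _ : Option (A × A) → TwistOrbits σ) :=
    Quotient.mk_surjective
  refine Nat.card_congr (Equiv.ofBijective (fun Q => ⟨Q.1.comap (Quotient.mk _),
    ⟨fun x y h => Q.2.1 _ _ h, fun x => ?_⟩, ?_⟩) ⟨fun P Q h => ?_, fun P => ?_⟩)
  · have h0 := twistInvolution_involutive σ (Quotient.mk _ x)
    rw [Setoid.comap_rel]
    conv_lhs => rw [← h0]
    exact Q.1.refl' _
  · rw [natCard_quotient_comap _ hmk, Q.2.2]
  · exact Subtype.ext (Setoid.comap_injective _ hmk (congrArg Subtype.val h))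
  · obtain ⟨P, hP, hk⟩ := P
    let f : TwistOrbits σ → Quotient P :=
      Quotient.lift (Quotient.mk P) fun x y h => Quotient.sound (hP.rel_of_orbitRel h)
    have hf : (Setoid.ker f).comap (Quotient.mk _) = P := by
      ext x y
      rw [Setoid.comap_rel, Setoid.ker_def]
      exact Quotient.eq
    refine ⟨⟨Setoid.ker f, fun x y => ?_, ?_⟩, Subtype.ext hf⟩
    · induction x using Quotient.inductionOn with
      | h x =>
        induction y using Quotient.inductionOn with
        | h y => exact fun h => Quotient.sound (hP.1 _ _ (Quotient.exact h))
    · rw [← natCard_quotient_comap _ hmk, hf, hk]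

end PairTwist

/-! ### From permutations to integer partitions -/

/-- The cycle lengths of a permutation of `Fin r`, as a partition of `r`. -/
def permPartition {r : ℕ} (σ : Equiv.Perm (Fin r)) : r.Partition where
  parts := σ.partition.parts
  parts_pos h := σ.partition.parts_pos h
  parts_sum := σ.partition.parts_sum.trans (Fintype.card_fin r)

theorem Nat.Partition.parts_eq_filter_add {r : ℕ} (lam : r.Partition) :
    lam.parts = lam.parts.filter (2 ≤ ·) +
      Multiset.replicate (r - (lam.parts.filter (2 ≤ ·)).sum) 1 := by
  have h1 : lam.parts.filter (fun l => ¬ 2 ≤ l) =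
      Multiset.replicate (lam.parts.filter (fun l => ¬ 2 ≤ l)).card 1 := by
    refine Multiset.eq_replicate_card.2 fun l hl => ?_
    rw [Multiset.mem_filter] at hl
    have := lam.parts_pos hl.1
    omega
  have h2 := Multiset.filter_add_not (2 ≤ ·) lam.parts
  have h3 := congrArg Multiset.sum h2
  rw [Multiset.sum_add, h1, Multiset.sum_replicate, lam.parts_sum, smul_eq_mul, mul_one] at h3
  conv_lhs => rw [← h2, h1]
  congr 2
  omega

theorem permPartition_eq_iff {r : ℕ} (σ : Equiv.Perm (Fin r)) (lam : r.Partition) :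
    permPartition σ = lam ↔ σ.cycleType = lam.parts.filter (2 ≤ ·) := by
  have h0 : (permPartition σ).parts.filter (2 ≤ ·) = σ.cycleType :=
    Equiv.Perm.filter_parts_partition_eq_cycleType
  constructor
  · rintro rfl
    exact h0.symm
  · intro h
    refine Nat.Partition.ext ?_
    rw [(permPartition σ).parts_eq_filter_add, lam.parts_eq_filter_add, h0, h]

/-- Rewrites the weight for the class-size formula in terms of `cycleType`, which omits the parts
equal to 1; these contribute only the factorial of their number. -/
theorem partitionWeight_eq {r : ℕ} (lam : r.Partition) :
    partitionWeight lam = (r - (lam.parts.filter (2 ≤ ·)).sum)! * (lam.parts.filter (2 ≤ ·)).prod *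
      ∏ n ∈ (lam.parts.filter (2 ≤ ·)).toFinset, ((lam.parts.filter (2 ≤ ·)).count n)! := by
  have hp := lam.parts_eq_filter_add
  set m := lam.parts.filter (2 ≤ ·) with hm
  set c := r - m.sum
  have hc1 : lam.parts.count 1 = c := by
    rw [hp, Multiset.count_add, Multiset.count_replicate_self, hm, Multiset.count_filter_of_neg]
    · simp
    · norm_num
  have hprod : ∏ l ∈ lam.parts.toFinset, l ^ lam.parts.count l = m.prod := by
    rw [← Finset.prod_multiset_count, hp]
    simp
  -- Adjoining 1 to the index set costs nothing even if 1 is not a part, since `0! = 1`.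
  rw [partitionWeight, Finset.prod_mul_distrib, hprod,
    Finset.prod_subset (Finset.subset_insert 1 lam.parts.toFinset)
      (f := fun l => (lam.parts.count l)!), ← Finset.mul_prod_erase _ _ (Finset.mem_insert_self _ _),
    hc1]
  · have h1 : (insert 1 lam.parts.toFinset).erase 1 = m.toFinset := by
      ext l
      simp only [Finset.mem_erase, Finset.mem_insert, Multiset.mem_toFinset, hm,
        Multiset.mem_filter]
      constructor
      · rintro ⟨h, h' | h'⟩
        · exact absurd h' h
        · have := lam.parts_pos h'
          exact ⟨h', by omega⟩
      · rintro ⟨h, h'⟩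
        exact ⟨by omega, Or.inr h⟩
    rw [h1]
    have h2 : ∀ l ∈ m.toFinset, (lam.parts.count l)! = (m.count l)! := by
      intro l hl
      rw [Multiset.mem_toFinset, hm, Multiset.mem_filter] at hl
      rw [hm, Multiset.count_filter_of_pos hl.2]
    rw [Finset.prod_congr rfl h2]
    ring
  · intro l _ hl
    rw [Multiset.mem_toFinset] at hl
    rw [Multiset.count_eq_zero_of_notMem hl, Nat.factorial_zero]

theorem card_permPartition_mul {r : ℕ} (lam : r.Partition) :
    (Finset.univ.filter fun σ : Equiv.Perm (Fin r) => permPartition σ = lam).card *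
      partitionWeight lam = r ! := by
  have h := Equiv.Perm.card_of_cycleType_mul_eq (Fin r) (lam.parts.filter (2 ≤ ·))
  rw [Fintype.card_fin, ← partitionWeight_eq, if_pos] at h
  · simpa only [permPartition_eq_iff] using h
  · refine ⟨?_, fun a ha => (Multiset.mem_filter.1 ha).2⟩
    have := congrArg Multiset.sum (Multiset.filter_add_not (2 ≤ ·) lam.parts)
    rw [Multiset.sum_add, lam.parts_sum] at this
    omega

theorem partitionWeight_ne_zero {r : ℕ} (lam : r.Partition) : partitionWeight lam ≠ 0 :=
  right_ne_zero_of_mul ((card_permPartition_mul lam).trans_ne (Nat.factorial_ne_zero r))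

theorem sum_partition_div_weight {r : ℕ} (f : r.Partition → ℚ) :
    ∑ lam : r.Partition, f lam / (partitionWeight lam : ℚ) =
      (∑ σ : Equiv.Perm (Fin r), f (permPartition σ)) / (r ! : ℚ) := by
  rw [← Finset.sum_fiberwise_of_maps_to (s := Finset.univ) (t := Finset.univ)
    (g := fun σ : Equiv.Perm (Fin r) => permPartition σ) (fun _ _ => Finset.mem_univ _),
    Finset.sum_div]
  refine Finset.sum_congr rfl fun lam _ => ?_
  rw [Finset.sum_congr rfl fun σ hσ => congrArg f (Finset.mem_filter.1 hσ).2, Finset.sum_const,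
    nsmul_eq_mul, ← card_permPartition_mul lam, Nat.cast_mul]
  have h1 : (partitionWeight lam : ℚ) ≠ 0 := Nat.cast_ne_zero.2 (partitionWeight_ne_zero lam)
  have h2 : ((Finset.univ.filter fun σ : Equiv.Perm (Fin r) => permPartition σ = lam).card : ℚ) ≠ 0 :=
    Nat.cast_ne_zero.2
      (left_ne_zero_of_mul ((card_permPartition_mul lam).trans_ne (Nat.factorial_ne_zero r)))
  field_simp

theorem selfDualInnerSum_eq (n : ℕ) {r : ℕ} (lam : r.Partition) :
    selfDualInnerSum n lam =
      invariantPartitionCount (partitionZeta lam) (partitionEta lam + 1) (n - r) := by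
  refine Finset.sum_congr rfl fun j hj => ?_
  have hj' := Finset.mem_range.1 hj
  congr 1
  refine Finset.sum_congr rfl fun t _ => ?_
  -- Here `j ≤ ζ`, so the subtractions are genuine; the 1 becomes the fixed point `none`.
  rw [show partitionZeta lam + partitionEta lam - j + 1 =
    partitionZeta lam - j + (partitionEta lam + 1) by omega]

theorem selfDualBound_eq (n : ℕ) :
    selfDualBound n = ∑ r ∈ Finset.Icc 1 (n - 2),
      (∑ σ : Equiv.Perm (Fin r), (Nat.card {P : Setoid (Option (Fin r × Fin r)) //
        IsTwistInvariant σ P ∧ Nat.card (Quotient P) = n - r} : ℚ)) / (r ! : ℚ) := by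
  refine Finset.sum_congr rfl fun r _ => ?_
  rw [sum_partition_div_weight fun lam => (selfDualInnerSum n lam : ℚ)]
  congr 1
  refine Finset.sum_congr rfl fun σ _ => ?_
  rw [natCard_isTwistInvariant σ (permPartition σ) rfl, selfDualInnerSum_eq]

/-! ### The semigroup of a partition of the pairs -/

section PairSemigroup

variable {A B : Type}

/-- The map induced on pairs, with an additional point, by a bijection. -/
def pairMap (e : A ≃ B) : Option (A × A) ≃ Option (B × B) :=
  Equiv.optionCongr (e.prodCongr e)

theorem pairMap_none (e : A ≃ B) : pairMap e none = none := rfl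

theorem pairMap_some (e : A ≃ B) (a b : A) : pairMap e (some (a, b)) = some (e a, e b) := rfl

/-- The exchange of the components of a pair. -/
def pairSwap (A : Type) : Option (A × A) ≃ Option (A × A) :=
  Equiv.optionCongr (Equiv.prodComm A A)

/-- The semigroup on the disjoint union of `A` and the set of blocks of `P` in which the product of
two elements of `A` is the block of their pair, and every other product is the block of `none`. -/
def PairSemigroup (P : Setoid (Option (A × A))) : Type := A ⊕ Quotient P

namespace PairSemigroup

variable (P : Setoid (Option (A × A))) (Q : Setoid (Option (B × B)))

/-- The generators. -/
def gen (a : A) : PairSemigroup P := Sum.inl a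

/-- The block of a pair. -/
def block (x : Option (A × A)) : PairSemigroup P := Sum.inr (Quotient.mk P x)

/-- The multiplication. -/
def mul : PairSemigroup P → PairSemigroup P → PairSemigroup P
  | Sum.inl a, Sum.inl b => block P (some (a, b))
  | Sum.inl _, Sum.inr _ => block P none
  | Sum.inr _, Sum.inl _ => block P none
  | Sum.inr _, Sum.inr _ => block P none

instance : Semigroup (PairSemigroup P) where
  mul := mul P
  mul_assoc := by
    rintro (a | a) (b | b) (c | c) <;> rfl

theorem gen_mul_gen (a b : A) : gen P a * gen P b = block P (some (a, b)) := rfl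

theorem block_mul_block (x y : Option (A × A)) : block P x * block P y = block P none := rfl

theorem block_mul_gen (x : Option (A × A)) (a : A) : block P x * gen P a = block P none := rfl

theorem gen_mul_block (x : Option (A × A)) (a : A) : gen P a * block P x = block P none := rfl

theorem gen_or_block (s : PairSemigroup P) : (∃ a, s = gen P a) ∨ ∃ x, s = block P x := by
  rcases s with a | q
  · exact Or.inl ⟨a, rfl⟩
  · induction q using Quotient.inductionOn with
    | h x => exact Or.inr ⟨x, rfl⟩

theorem gen_ne_block (a : A) (x : Option (A × A)) : gen P a ≠ block P x := by
  intro h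
  exact absurd h (by simp [gen, block])

theorem gen_injective : Function.Injective (gen P) := Sum.inl_injective

theorem block_eq_block_iff (x y : Option (A × A)) : block P x = block P y ↔ P x y := by
  rw [block, block]
  exact Sum.inr_injective.eq_iff.trans Quotient.eq

theorem mul_eq_block (s t : PairSemigroup P) : ∃ x, s * t = block P x := by
  rcases gen_or_block P s with ⟨a, rfl⟩ | ⟨x, rfl⟩ <;>
    rcases gen_or_block P t with ⟨b, rfl⟩ | ⟨y, rfl⟩
  exacts [⟨_, gen_mul_gen P a b⟩, ⟨_, gen_mul_block P y a⟩, ⟨_, block_mul_gen P x b⟩,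
    ⟨_, block_mul_block P x y⟩]

theorem block_eq_mul (x : Option (A × A)) : ∃ s t, block P x = s * t := by
  rcases x with _ | ⟨a, b⟩
  · exact ⟨block P none, block P none, rfl⟩
  · exact ⟨gen P a, gen P b, rfl⟩

theorem natCard_eq [Finite A] :
    Nat.card (PairSemigroup P) = Nat.card A + Nat.card (Quotient P) := Nat.card_sum

instance [Finite A] : Finite (PairSemigroup P) := inferInstanceAs (Finite (A ⊕ Quotient P))

variable {P Q}

/-- A bijection that identifies two partitions of pairs is an isomorphism of the semigroups. -/
def congr (e : A ≃ B) (h : ∀ x y, P x y ↔ Q (pairMap e x) (pairMap e y)) :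
    PairSemigroup P ≃* PairSemigroup Q where
  toEquiv := Equiv.sumCongr e (Quotient.congr (pairMap e) h)
  map_mul' := by
    rintro (a | a) (b | b) <;> rfl

theorem congr_block (e : A ≃ B) (h : ∀ x y, P x y ↔ Q (pairMap e x) (pairMap e y))
    (x : Option (A × A)) : congr e h (block P x) = block Q (pairMap e x) := rfl

theorem exists_map_block (f : PairSemigroup P ≃* PairSemigroup Q) (x : Option (A × A)) :
    ∃ y, f (block P x) = block Q y := by
  obtain ⟨s, t, h⟩ := block_eq_mul P x
  rw [h, map_mul]
  exact mul_eq_block Q _ _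

/-- The blocks are exactly the products, so isomorphisms in both directions preserve them, and hence
also the generators. -/
theorem exists_map_gen (f : PairSemigroup P ≃* PairSemigroup Q) (a : A) :
    ∃ b, f (gen P a) = gen Q b := by
  rcases gen_or_block Q (f (gen P a)) with h | ⟨y, h⟩
  · exact h
  · obtain ⟨x, hx⟩ := exists_map_block f.symm y
    rw [← h, MulEquiv.symm_apply_apply] at hx
    exact absurd hx (gen_ne_block P a x)

theorem exists_equiv_of_mulEquiv (f : PairSemigroup P ≃* PairSemigroup Q) :
    ∃ e : A ≃ B, ∀ x y, P x y ↔ Q (pairMap e x) (pairMap e y) := by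
  choose u hu using exists_map_gen f
  choose v hv using exists_map_gen f.symm
  let e : A ≃ B :=
    { toFun := u
      invFun := v
      left_inv := fun a => gen_injective P (by rw [← hv, ← hu, MulEquiv.symm_apply_apply])
      right_inv := fun b => gen_injective Q (by rw [← hu, ← hv, MulEquiv.apply_symm_apply]) }
  have he : ∀ x, f (block P x) = block Q (pairMap e x) := by
    rintro (_ | ⟨a, b⟩)
    · obtain ⟨y, hy⟩ := exists_map_block f none
      rw [pairMap_none, ← block_mul_block P none none, map_mul, hy, block_mul_block]
    · rw [pairMap_some, ← gen_mul_gen, ← gen_mul_gen, map_mul, hu, hu]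
      rfl
  refine ⟨e, fun x y => ?_⟩
  rw [← block_eq_block_iff, ← block_eq_block_iff, ← he, ← he, f.injective.eq_iff]

variable (P)

/-- The opposite semigroup belongs to the partition with exchanged components. -/
def opEquiv : PairSemigroup (P.comap (pairSwap A)) ≃* (PairSemigroup P)ᵐᵒᵖ where
  toEquiv := (Equiv.sumCongr (Equiv.refl A)
    (Quotient.congr (pairSwap A) fun _ _ => Iff.rfl)).trans MulOpposite.opEquiv
  map_mul' := by
    rintro (a | a) (b | b) <;> rfl

theorem isThreeNilpotent [Finite A] (h : 2 ≤ Nat.card (Quotient P)) :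
    IsThreeNilpotent (PairSemigroup P) := by
  refine ⟨block P none, fun s => ?_, fun s t u => ?_, ?_⟩
  · rcases gen_or_block P s with ⟨a, rfl⟩ | ⟨x, rfl⟩ <;> exact ⟨rfl, rfl⟩
  · obtain ⟨x, hx⟩ := mul_eq_block P s t
    rw [hx]
    rcases gen_or_block P u with ⟨a, rfl⟩ | ⟨y, rfl⟩ <;> rfl
  · have : Nontrivial (Quotient P) := Finite.one_lt_card_iff_nontrivial.1 h
    obtain ⟨q, hq⟩ := exists_ne (Quotient.mk P none)
    induction q using Quotient.inductionOn with
    | h x =>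
      rcases x with _ | ⟨a, b⟩
      · exact absurd rfl hq
      · refine ⟨gen P a, gen P b, fun h => hq (Quotient.sound ?_)⟩
        rwa [gen_mul_gen, block_eq_block_iff] at h

variable {P}

theorem rel_of_isSemirigid (hP : IsSemirigid (PairSemigroup P)) (e : A ≃ A)
    (he : ∀ x y, P x y ↔ P (pairMap e x) (pairMap e y)) (x : Option (A × A)) :
    P x (pairMap e x) := by
  obtain ⟨s, t, h⟩ := block_eq_mul P x
  have := hP (congr e he) s t
  rw [← h, congr_block, block_eq_block_iff] at this
  exact P.symm' this

end PairSemigroup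

end PairSemigroup

theorem IsThreeNilpotent.of_mulEquiv {S T : Type} [Semigroup S] [Semigroup T] (f : S ≃* T)
    (h : IsThreeNilpotent S) : IsThreeNilpotent T := by
  obtain ⟨z, h1, h2, a, b, h3⟩ := h
  refine ⟨f z, fun x => ?_, fun a b c => ?_, f a, f b, fun h => h3 (f.injective ?_)⟩
  · obtain ⟨x, rfl⟩ := f.surjective x
    rw [← map_mul, ← map_mul, (h1 x).1, (h1 x).2]
    exact ⟨rfl, rfl⟩
  · obtain ⟨a, rfl⟩ := f.surjective a
    obtain ⟨b, rfl⟩ := f.surjective b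
    obtain ⟨c, rfl⟩ := f.surjective c
    rw [← map_mul, ← map_mul, h2]
  · rw [map_mul, h]

theorem IsSelfDual.of_mulEquiv {S T : Type} [Semigroup S] [Semigroup T] (f : S ≃* T)
    (h : IsSelfDual S) : IsSelfDual T :=
  let ⟨g⟩ := h
  ⟨(f.symm.trans g).trans f.op⟩

theorem IsSemirigid.of_mulEquiv {S T : Type} [Semigroup S] [Semigroup T] (f : S ≃* T)
    (h : IsSemirigid S) : IsSemirigid T := by
  intro g a b
  have := h ((f.trans g).trans f.symm) (f.symm a) (f.symm b)
  simpa using congrArg f this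

/-- Every finite 3-nilpotent semigroup comes from a partition of pairs. -/
theorem IsThreeNilpotent.exists_pairSemigroup {S : Type} [Semigroup S] [Finite S] {n : ℕ}
    (hn : Nat.card S = n) (h : IsThreeNilpotent S) :
    ∃ r ∈ Finset.Icc 1 (n - 2), ∃ P : Setoid (Option (Fin r × Fin r)),
      Nat.card (Quotient P) = n - r ∧ Nonempty (PairSemigroup P ≃* S) := by
  classical
  obtain ⟨z, hz, h3, a₀, b₀, h0⟩ := h
  let D : Set S := {x | ∃ a b, x = a * b}
  have hDl : ∀ x ∈ D, ∀ y, x * y = z := by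
    rintro _ ⟨a, b, rfl⟩ y
    exact h3 a b y
  have hDr : ∀ x ∈ D, ∀ y, y * x = z := by
    rintro _ ⟨a, b, rfl⟩ y
    rw [← mul_assoc]
    exact h3 y a b
  have hzD : z ∈ D := ⟨z, z, ((hz z).1).symm⟩
  have hcard : Nat.card (Dᶜ : Set S) + Nat.card D = n := by
    rw [← hn, add_comm, Nat.card_coe_set_eq, Nat.card_coe_set_eq, Set.ncard_add_ncard_compl]
  have hD2 : 2 ≤ Nat.card D := by
    have : Nontrivial D := ⟨⟨a₀ * b₀, a₀, b₀, rfl⟩, ⟨z, hzD⟩, fun h => h0 (congrArg Subtype.val h)⟩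
    exact Finite.one_lt_card
  have hA1 : 1 ≤ Nat.card (Dᶜ : Set S) := by
    have : Nonempty (Dᶜ : Set S) := ⟨⟨a₀, fun h => h0 (hDl _ h _)⟩⟩
    exact Nat.card_pos
  have e : Fin (Nat.card (Dᶜ : Set S)) ≃ (Dᶜ : Set S) := (Finite.equivFin _).symm
  -- `none` is sent to the zero. Every product with a factor in `D = S²` is zero, so products of
  -- elements outside `D`, together with zero, exhaust `D`.
  let ψ : Option (Fin (Nat.card (Dᶜ : Set S)) × Fin (Nat.card (Dᶜ : Set S))) → D := fun x =>
    x.elim ⟨z, hzD⟩ fun p => ⟨e p.1 * e p.2, _, _, rfl⟩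
  have hψ : Function.Surjective ψ := by
    rintro ⟨_, a, b, rfl⟩
    by_cases ha : a ∈ D
    · exact ⟨none, Subtype.ext (hDl a ha b).symm⟩
    · by_cases hb : b ∈ D
      · exact ⟨none, Subtype.ext (hDr b hb a).symm⟩
      · exact ⟨some (e.symm ⟨a, ha⟩, e.symm ⟨b, hb⟩), Subtype.ext (by
          change (e (e.symm ⟨a, ha⟩)).1 * (e (e.symm ⟨b, hb⟩)).1 = a * b
          rw [Equiv.apply_symm_apply, Equiv.apply_symm_apply])⟩
  let q : Quotient (Setoid.ker ψ) ≃ D := Setoid.quotientKerEquivOfSurjective ψ hψ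
  let F : PairSemigroup (Setoid.ker ψ) → S := Sum.elim (fun i => (e i).1) fun x => (q x).1
  -- The range of `r` is exact: `a₀` lies outside `D`, and `D` contains both zero and `a₀ * b₀`.
  refine ⟨_, Finset.mem_Icc.2 ⟨hA1, by omega⟩, Setoid.ker ψ, ?_, ⟨MulEquiv.ofBijective
    (⟨F, ?_⟩ : PairSemigroup (Setoid.ker ψ) →ₙ* S) ⟨?_, ?_⟩⟩⟩
  · rw [Nat.card_congr q]
    omega
  · rintro (a | a) (b | b)
    · rfl
    · exact (hDr _ (q b).2 _).symm
    · exact (hDl _ (q a).2 _).symm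
    · exact (hDl _ (q a).2 _).symm
  · rintro (a | a) (b | b) hab
    · exact congrArg Sum.inl (e.injective (Subtype.ext hab))
    · exact absurd (q b).2 (by rw [← show (e a).1 = (q b).1 from hab]; exact (e a).2)
    · exact absurd (q a).2 (by rw [show (q a).1 = (e b).1 from hab]; exact (e b).2)
    · exact congrArg Sum.inr (q.injective (Subtype.ext hab))
  · intro x
    by_cases hx : x ∈ D
    · exact ⟨Sum.inr (q.symm ⟨x, hx⟩), by
        change (q (q.symm ⟨x, hx⟩)).1 = x
        rw [Equiv.apply_symm_apply]⟩
    · exact ⟨Sum.inl (e.symm ⟨x, hx⟩), by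
        change (e (e.symm ⟨x, hx⟩)).1 = x
        rw [Equiv.apply_symm_apply]⟩

/-! ### The action on partitions of pairs -/

/-- The partitions of the pairs of elements of `A`, with an additional point, into `k` blocks. -/
def PairPartition (A : Type) (k : ℕ) : Type :=
  {P : Setoid (Option (A × A)) // Nat.card (Quotient P) = k}

namespace PairPartition

variable {A : Type} {k : ℕ}

instance [Finite A] : Finite (PairPartition A k) :=
  inferInstanceAs (Finite {P : Setoid (Option (A × A)) // Nat.card (Quotient P) = k})

instance : MulAction (Equiv.Perm A) (PairPartition A k) where
  smul σ P := ⟨P.1.comap (pairMap σ⁻¹), by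
    rw [natCard_quotient_comap _ (Equiv.surjective _), P.2]⟩
  one_smul P := Subtype.ext (by
    ext x y
    rcases x with _ | ⟨a, b⟩ <;> rcases y with _ | ⟨c, d⟩ <;> rfl)
  mul_smul σ ρ P := Subtype.ext (by
    ext x y
    rcases x with _ | ⟨a, b⟩ <;> rcases y with _ | ⟨c, d⟩ <;> rfl)

/-- The dual partition. -/
def dual (P : PairPartition A k) : PairPartition A k :=
  ⟨P.1.comap (pairSwap A), by rw [natCard_quotient_comap _ (Equiv.surjective _), P.2]⟩

theorem dual_smul (σ : Equiv.Perm A) (P : PairPartition A k) : dual (σ • P) = σ • dual P :=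
  Subtype.ext (by
    ext x y
    rcases x with _ | ⟨a, b⟩ <;> rcases y with _ | ⟨c, d⟩ <;> rfl)

theorem smul_eq_iff (σ : Equiv.Perm A) (P Q : PairPartition A k) :
    σ • P = Q ↔ ∀ x y, P.1 x y ↔ Q.1 (pairMap σ x) (pairMap σ y) := by
  have hinv : ∀ x, pairMap σ⁻¹ (pairMap σ x) = x := by
    rintro (_ | ⟨a, b⟩)
    · rfl
    · simp [pairMap_some]
  have hrel : ∀ x y, (σ • P).1 x y ↔ P.1 (pairMap σ⁻¹ x) (pairMap σ⁻¹ y) := fun _ _ => Iff.rfl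
  constructor
  · rintro rfl x y
    rw [hrel, hinv, hinv]
  · intro h
    refine Subtype.ext (Setoid.ext fun x y => ?_)
    obtain ⟨x, rfl⟩ := (pairMap σ).surjective x
    obtain ⟨y, rfl⟩ := (pairMap σ).surjective y
    rw [hrel, hinv, hinv, h]

theorem smul_dual_eq_iff (σ : Equiv.Perm A) (P : PairPartition A k) :
    σ • dual P = P ↔ ∀ x y, P.1 x y ↔ P.1 (pairTwist σ x) (pairTwist σ y) := by
  rw [smul_eq_iff]
  have h1 : ∀ x, pairMap σ (pairSwap A x) = pairTwist σ x := by
    rintro (_ | ⟨a, b⟩) <;> rfl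
  have h2 : ∀ x, pairSwap A (pairSwap A x) = x := by
    rintro (_ | ⟨a, b⟩) <;> rfl
  have hrel : ∀ x y, (dual P).1 x y ↔ P.1 (pairSwap A x) (pairSwap A y) := fun _ _ => Iff.rfl
  constructor
  · intro h x y
    rw [← h1, ← h1, ← h, hrel, h2, h2]
  · intro h x y
    rw [hrel, h, ← h1, ← h1, h2, h2]

/-- The converse implication needed for equality comes from applying the twist once more, as its
square moves no point out of its block. -/
theorem smul_dual_eq_of_isTwistInvariant {σ : Equiv.Perm A} {P : PairPartition A k}
    (h : IsTwistInvariant σ P.1) : σ • dual P = P := by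
  refine (smul_dual_eq_iff σ P).2 fun x y => ⟨h.1 x y, fun hxy => ?_⟩
  exact P.1.trans' (h.2 x) (P.1.trans' (h.1 _ _ hxy) (P.1.symm' (h.2 y)))

/-- The squared twist is the map induced by `σ²` and preserves `P`, so it comes from an
automorphism, which by semirigidity fixes every block. This is where the lower estimate uses
semirigidity. -/
theorem isTwistInvariant_of_smul_dual_eq {σ : Equiv.Perm A} {P : PairPartition A k}
    (hP : IsSemirigid (PairSemigroup P.1)) (h : σ • dual P = P) : IsTwistInvariant σ P.1 := by
  rw [smul_dual_eq_iff] at h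
  refine ⟨fun x y => (h x y).1, fun x => ?_⟩
  have h1 : ∀ x, pairMap (σ * σ) x = pairTwist σ (pairTwist σ x) := by
    rintro (_ | ⟨a, b⟩) <;> rfl
  rw [← h1]
  refine PairSemigroup.rel_of_isSemirigid hP _ (fun x y => ?_) x
  rw [h1, h1, ← h, ← h]

theorem mem_orbit_iff (P Q : PairPartition A k) :
    Q ∈ MulAction.orbit (Equiv.Perm A) P ↔
      Nonempty (PairSemigroup Q.1 ≃* PairSemigroup P.1) := by
  constructor
  · rintro ⟨σ, h⟩
    exact ⟨(PairSemigroup.congr σ ((smul_eq_iff σ P Q).1 h)).symm⟩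
  · rintro ⟨f⟩
    obtain ⟨e, he⟩ := PairSemigroup.exists_equiv_of_mulEquiv f.symm
    exact ⟨e, (smul_eq_iff e P Q).2 he⟩

theorem dual_mem_orbit_iff (P : PairPartition A k) :
    dual P ∈ MulAction.orbit (Equiv.Perm A) P ↔ IsSelfDual (PairSemigroup P.1) := by
  rw [mem_orbit_iff]
  constructor
  · rintro ⟨f⟩
    exact ⟨f.symm.trans (PairSemigroup.opEquiv P.1)⟩
  · rintro ⟨f⟩
    exact ⟨(f.trans (PairSemigroup.opEquiv P.1).symm).symm⟩

/-- The number of twists that leave the partition invariant. -/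
noncomputable def twistCount (P : PairPartition A k) : ℕ :=
  Nat.card {σ : Equiv.Perm A // IsTwistInvariant σ P.1}

theorem twistCount_le [Finite A] (P : PairPartition A k) :
    twistCount P ≤ Nat.card {σ : Equiv.Perm A // σ • dual P = P} :=
  Nat.card_le_card_of_injective
    (Subtype.map id fun _ h => smul_dual_eq_of_isTwistInvariant h)
    (Subtype.map_injective _ Function.injective_id)

theorem twistCount_eq {P : PairPartition A k} (hP : IsSemirigid (PairSemigroup P.1)) :
    twistCount P = Nat.card {σ : Equiv.Perm A // σ • dual P = P} :=
  Nat.card_congr (Equiv.subtypeEquivRight fun _ =>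
    ⟨smul_dual_eq_of_isTwistInvariant, isTwistInvariant_of_smul_dual_eq hP⟩)

/-- A single invariant twist of some `P` in the orbit already makes `P`, and with it `P₀`,
self-dual. -/
theorem sum_twistCount_eq_zero (P₀ : PairPartition A k)
    (S : Finset (PairPartition A k)) (hS : ∀ P, P ∈ S ↔ P ∈ MulAction.orbit (Equiv.Perm A) P₀)
    (h : ¬ IsSelfDual (PairSemigroup P₀.1)) :
    ∑ P ∈ S, twistCount P = 0 := by
  refine Finset.sum_eq_zero fun P hP => Nat.card_eq_zero.2 (Or.inl ⟨fun ⟨σ, hσ⟩ => h ?_⟩)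
  have h1 := (hS P).1 hP
  have h2 : dual P ∈ MulAction.orbit (Equiv.Perm A) P :=
    ⟨σ⁻¹, inv_smul_eq_iff.2 (smul_dual_eq_of_isTwistInvariant hσ).symm⟩
  obtain ⟨f⟩ := (mem_orbit_iff P₀ P).1 h1
  exact ((dual_mem_orbit_iff P).1 h2).of_mulEquiv f

/-- In the self-dual case the Burnside count over the orbit, without the condition on the squared
twist, is exactly the group order. -/
theorem sum_twistCount_le [Finite A] (P₀ : PairPartition A k)
    (S : Finset (PairPartition A k)) (hS : ∀ P, P ∈ S ↔ P ∈ MulAction.orbit (Equiv.Perm A) P₀) :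
    ∑ P ∈ S, twistCount P ≤ Nat.card (Equiv.Perm A) := by
  by_cases h : IsSelfDual (PairSemigroup P₀.1)
  · rw [← sum_orbit_natCard_smul_eq S P₀ hS dual
      (map_mem_orbit dual_smul ((dual_mem_orbit_iff P₀).2 h))]
    exact Finset.sum_le_sum fun P _ => twistCount_le P
  · rw [sum_twistCount_eq_zero P₀ S hS h]
    exact Nat.zero_le _

theorem sum_twistCount_eq [Finite A] (P₀ : PairPartition A k)
    (S : Finset (PairPartition A k)) (hS : ∀ P, P ∈ S ↔ P ∈ MulAction.orbit (Equiv.Perm A) P₀)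
    (h : IsSelfDual (PairSemigroup P₀.1))
    (h' : IsSemirigid (PairSemigroup P₀.1)) :
    ∑ P ∈ S, twistCount P = Nat.card (Equiv.Perm A) := by
  rw [← sum_orbit_natCard_smul_eq S P₀ hS dual
    (map_mem_orbit dual_smul ((dual_mem_orbit_iff P₀).2 h))]
  refine Finset.sum_congr rfl fun P hP => twistCount_eq ?_
  obtain ⟨f⟩ := (mem_orbit_iff P₀ P).1 ((hS P).1 hP)
  exact h'.of_mulEquiv f.symm

end PairPartition

theorem selfDualBound_eq_sum_twistCount (n : ℕ)
    [∀ r, Fintype (PairPartition (Fin r) (n - r))] :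
    selfDualBound n = ∑ r ∈ Finset.Icc 1 (n - 2),
      ∑ P : PairPartition (Fin r) (n - r), (P.twistCount : ℚ) / (r ! : ℚ) := by
  classical
  rw [selfDualBound_eq]
  refine Finset.sum_congr rfl fun r _ => ?_
  rw [← Finset.sum_div]
  congr 1
  have h : ∀ σ : Equiv.Perm (Fin r), Nat.card {P : Setoid (Option (Fin r × Fin r)) //
      IsTwistInvariant σ P ∧ Nat.card (Quotient P) = n - r} =
      Nat.card {P : PairPartition (Fin r) (n - r) // IsTwistInvariant σ P.1} := fun σ =>
    Nat.card_congr ((Equiv.subtypeEquivRight fun _ => and_comm).trans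
      (Equiv.subtypeSubtypeEquivSubtypeInter
        (fun P : Setoid (Option (Fin r × Fin r)) => Nat.card (Quotient P) = n - r)
        (IsTwistInvariant σ)).symm)
  simp only [h, PairPartition.twistCount, natCard_subtype_eq_sum]
  push_cast
  exact Finset.sum_comm

/-! ### The isomorphism classes -/

theorem exists_mulEquiv_semigroupOn {S : Type} [Semigroup S] [Finite S] {n : ℕ}
    (h : Nat.card S = n) : ∃ s : Semigroup (Fin n), Nonempty (S ≃* SemigroupOn s) := by
  subst h
  let e := Finite.equivFin S
  refine ⟨{ mul := fun a b => e (e.symm a * e.symm b), mul_assoc := fun a b c => ?_ },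
    ⟨{ toEquiv := e, map_mul' := fun a b => ?_ }⟩⟩
  · change e (e.symm (e (e.symm a * e.symm b)) * e.symm c) =
      e (e.symm a * e.symm (e (e.symm b * e.symm c)))
    simp [mul_assoc]
  · change e (a * b) = e (e.symm (e a) * e.symm (e b))
    simp

/-- The pairs of an admissible number of generators and a partition. -/
abbrev PairData (n : ℕ) : Type :=
  Σ r : {r // r ∈ Finset.Icc 1 (n - 2)}, PairPartition (Fin r) (n - r)

theorem PairData.natCard_pairSemigroup {n : ℕ} (x : PairData n) :
    Nat.card (PairSemigroup x.2.1) = n := by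
  rw [PairSemigroup.natCard_eq, x.2.2, Nat.card_fin]
  have := Finset.mem_Icc.1 x.1.2
  omega

theorem PairData.isThreeNilpotent {n : ℕ} (x : PairData n) :
    IsThreeNilpotent (PairSemigroup x.2.1) := by
  refine PairSemigroup.isThreeNilpotent _ ?_
  have := Finset.mem_Icc.1 x.1.2
  rw [x.2.2]
  omega

/-- A representative of the isomorphism class on `Fin n`. -/
@[reducible]
noncomputable def PairData.semigroup {n : ℕ} (x : PairData n) : Semigroup (Fin n) :=
  (exists_mulEquiv_semigroupOn x.natCard_pairSemigroup).choose

/-- The representative is isomorphic to the semigroup of the partition. -/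
noncomputable def PairData.mulEquiv {n : ℕ} (x : PairData n) :
    PairSemigroup x.2.1 ≃* SemigroupOn x.semigroup :=
  (exists_mulEquiv_semigroupOn x.natCard_pairSemigroup).choose_spec.some

theorem isoClassOf_eq_iff {n : ℕ} (s t : Semigroup (Fin n)) :
    isoClassOf s = isoClassOf t ↔ Nonempty (SemigroupOn s ≃* SemigroupOn t) :=
  Quotient.eq

theorem PairData.isoClassOf_eq_iff {n : ℕ} (x y : PairData n) :
    isoClassOf x.semigroup = isoClassOf y.semigroup ↔
      Nonempty (PairSemigroup x.2.1 ≃* PairSemigroup y.2.1) := by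
  rw [_root_.isoClassOf_eq_iff]
  exact ⟨fun ⟨f⟩ => ⟨(x.mulEquiv.trans f).trans y.mulEquiv.symm⟩,
    fun ⟨f⟩ => ⟨(x.mulEquiv.symm.trans f).trans y.mulEquiv⟩⟩

theorem exists_pairData_isoClassOf {n : ℕ} {s : Semigroup (Fin n)}
    (hs : IsThreeNilpotent (SemigroupOn s)) :
    ∃ x : PairData n, isoClassOf x.semigroup = isoClassOf s ∧
      Nonempty (SemigroupOn s ≃* PairSemigroup x.2.1) := by
  have : Finite (SemigroupOn s) := inferInstanceAs (Finite (Fin n))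
  obtain ⟨r, hr, P, hP, ⟨f⟩⟩ := hs.exists_pairSemigroup (n := n)
    (show Nat.card (SemigroupOn s) = n from Nat.card_fin n)
  let x : PairData n := ⟨⟨r, hr⟩, ⟨P, hP⟩⟩
  exact ⟨x, (isoClassOf_eq_iff _ _).2 ⟨x.mulEquiv.symm.trans f⟩, ⟨f.symm⟩⟩

section ClassWeight

open Classical

variable (n : ℕ) [∀ r, Fintype (PairPartition (Fin r) (n - r))]

/-- The contribution of an isomorphism class to the bound. -/
noncomputable def classWeight (c : SemigroupIsoClass n) : ℚ :=
  ∑ x ∈ Finset.univ.filter (fun x : PairData n => isoClassOf x.semigroup = c),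
    (x.2.twistCount : ℚ) / ((x.1 : ℕ)! : ℚ)

theorem selfDualBound_eq_sum_classWeight [Fintype (SemigroupIsoClass n)] :
    selfDualBound n = ∑ c, classWeight n c := by
  have h := Finset.sum_fiberwise_of_maps_to (s := Finset.univ) (t := Finset.univ)
    (g := fun x : PairData n => isoClassOf x.semigroup) (fun _ _ => Finset.mem_univ _)
    (fun x : PairData n => (x.2.twistCount : ℚ) / ((x.1 : ℕ)! : ℚ))
  rw [selfDualBound_eq_sum_twistCount]
  simp only [classWeight]
  rw [h, Fintype.sum_sigma,
    ← Finset.sum_coe_sort (Finset.Icc 1 (n - 2)) fun r =>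
      ∑ P : PairPartition (Fin r) (n - r), (P.twistCount : ℚ) / (r ! : ℚ)]

theorem classWeight_nonneg (c : SemigroupIsoClass n) : 0 ≤ classWeight n c :=
  Finset.sum_nonneg fun _ _ => div_nonneg (Nat.cast_nonneg _) (Nat.cast_nonneg _)

/-- An isomorphism matches the generators, so a class involves only one `r`; within that `r` it is
one orbit of the permutations. -/
theorem classWeight_isoClassOf {r : ℕ} (hr : r ∈ Finset.Icc 1 (n - 2))
    (P₀ : PairPartition (Fin r) (n - r)) :
    classWeight n (isoClassOf (PairData.semigroup (⟨⟨r, hr⟩, P₀⟩ : PairData n))) =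
      ((∑ P ∈ Finset.univ.filter (fun P => P ∈ MulAction.orbit (Equiv.Perm (Fin r)) P₀),
        P.twistCount : ℕ) : ℚ) / (r ! : ℚ) := by
  have hset : Finset.univ.filter (fun x : PairData n => isoClassOf x.semigroup =
      isoClassOf (PairData.semigroup (⟨⟨r, hr⟩, P₀⟩ : PairData n))) =
      (Finset.univ.filter (fun P => P ∈ MulAction.orbit (Equiv.Perm (Fin r)) P₀)).map
        (Function.Embedding.sigmaMk (β := fun r : {r // r ∈ Finset.Icc 1 (n - 2)} =>
          PairPartition (Fin r) (n - r)) ⟨r, hr⟩) := by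
    ext ⟨⟨r', hr'⟩, P⟩
    simp only [Finset.mem_filter, Finset.mem_univ, true_and, Finset.mem_map,
      PairData.isoClassOf_eq_iff, PairPartition.mem_orbit_iff]
    constructor
    · rintro ⟨f⟩
      obtain ⟨e, -⟩ := PairSemigroup.exists_equiv_of_mulEquiv f
      obtain rfl : r' = r := by simpa using Nat.card_congr e
      exact ⟨P, ⟨f⟩, rfl⟩
    · rintro ⟨Q, hQ, h⟩
      cases h
      exact hQ
  rw [classWeight, hset, Finset.sum_map, Nat.cast_sum, Finset.sum_div]
  rfl

theorem classWeight_le_one (c : SemigroupIsoClass n) :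
    classWeight n c ≤ 1 ∧ (c ∉ selfDualThreeNilpotentClasses n → classWeight n c = 0) := by
  by_cases hc : ∃ x : PairData n, isoClassOf x.semigroup = c
  · obtain ⟨⟨⟨r, hr⟩, P₀⟩, rfl⟩ := hc
    rw [classWeight_isoClassOf]
    constructor
    · refine div_le_one_of_le₀ (Nat.cast_le.2 ?_) (Nat.cast_nonneg _)
      refine (PairPartition.sum_twistCount_le P₀ _ (by simp)).trans_eq ?_
      rw [Nat.card_perm, Nat.card_fin]
    · intro h
      rw [PairPartition.sum_twistCount_eq_zero P₀ _ (by simp), Nat.cast_zero, zero_div]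
      intro hd
      let x : PairData n := ⟨⟨r, hr⟩, P₀⟩
      exact h ⟨x.semigroup, ⟨x.isThreeNilpotent.of_mulEquiv x.mulEquiv,
        hd.of_mulEquiv x.mulEquiv⟩, rfl⟩
  · have : classWeight n c = 0 := by
      refine Finset.sum_eq_zero fun x hx => absurd ⟨x, (Finset.mem_filter.1 hx).2⟩ hc
    rw [this]
    exact ⟨zero_le_one, fun _ => rfl⟩

theorem classWeight_eq_one {c : SemigroupIsoClass n}
    (hc : c ∈ selfDualSemirigidThreeNilpotentClasses n) : classWeight n c = 1 := by
  obtain ⟨s, ⟨h1, h2, h3⟩, rfl⟩ := hc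
  obtain ⟨⟨⟨r, hr⟩, P₀⟩, hx, ⟨f⟩⟩ := exists_pairData_isoClassOf h1
  rw [← hx, classWeight_isoClassOf, PairPartition.sum_twistCount_eq P₀ _ (by simp)
    (h3.of_mulEquiv f) (h2.of_mulEquiv f), Nat.card_perm, Nat.card_fin]
  exact div_self (Nat.cast_ne_zero.2 (Nat.factorial_ne_zero r))

end ClassWeight

theorem ncard_eq_sum_ite {α : Type*} [Fintype α] (s : Set α) [DecidablePred (· ∈ s)] :
    (s.ncard : ℚ) = ∑ x, if x ∈ s then 1 else 0 := by
  rw [Set.ncard_eq_toFinset_card', Finset.sum_boole, ← Set.toFinset_ofPred]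
  rfl

theorem mainTheorem4 (n : ℕ) :
    ((selfDualSemirigidThreeNilpotentClasses n).ncard : ℚ) ≤ selfDualBound n ∧
      selfDualBound n ≤ ((selfDualThreeNilpotentClasses n).ncard : ℚ) := by
  classical
  have : ∀ r, Fintype (PairPartition (Fin r) (n - r)) := fun r => Fintype.ofFinite _
  have := Fintype.ofFinite (SemigroupIsoClass n)
  -- All three quantities become sums over isomorphism classes and are compared term by term: the
  -- weight lies between the indicators of the two sets.
  rw [selfDualBound_eq_sum_classWeight, ncard_eq_sum_ite, ncard_eq_sum_ite]
  constructor
  · refine Finset.sum_le_sum fun c _ => ?_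
    split_ifs with h
    · exact (classWeight_eq_one n h).ge
    · exact classWeight_nonneg n c
  · refine Finset.sum_le_sum fun c _ => ?_
    split_ifs with h
    · exact (classWeight_le_one n c).1
    · exact ((classWeight_le_one n c).2 h).le
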